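/- Let $n\ge 1$. For $0<s\le\infty$ and $1<q\le 2$ with conjugate exponent $p=q/(q-1)$, a $(q,s)$ atom on $\mathbb R^n$ is a function $a$ supported in a cube $Q$ (with sides parallel to the axes) with $\int_Q a=0$ and $p^{1/s}|Q|\big(\frac1{|Q|}\int_Q|a|^q\big)^{1/q}\le 1$ (where $1/\infty=0$). Let $\mathcal A_s\subset L^1(\mathbb R^n)$ be the set of all $(q,s)$ atoms, for all $1<q\le2$ and all cubes, and let $X_s$ be the space of all $f=\sum_j\lambda_ja_j$ (convergence in $L^1$) with $a_j\in\mathcal A_s$ and $\sum_j|\lambda_j|<\infty$, with norm $\|f\|_{X_s}=\inf\sum_j|\lambda_j|$ over all such representations. Fix a Schwartz function $\varphi$ on $\mathbb R^n$ with $\int\varphi\ne0$ and put $\varphi_t(x)=t^{-n}\varphi(x/t)$. The non-tangential maximal function of a tempered distribution $u$ is $Nu(x)=\sup\{|(u*\varphi_t)(y)|: t>0,\ |x-y|<t\}$. For $1\le r\le\infty$, the Hardy–Lorentz space $H^{1,r}$ consists of the tempered distributions $u$ with $Nu$ in the Lorentz space $L^{1,r}$, with $\|u\|_{H^{1,r}}=\|Nu\|_{1,r}$;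 here $\|g\|_{1,r}=\big(\int_0^\infty (t\,g^*(t))^r\,\frac{dt}t\big)^{1/r}$ for $r<\infty$, $\|g\|_{1,\infty}=\sup_{t>0}t\,g^*(t)$, and $g^*$ is the non-increasing rearrangement of $|g|$. Proposition 2.2. There is a constant $C$, depending only on $n$ and $\varphi$, such that for all $1<s<\infty$ and $s<r\le\infty$, every $f\in X_s$ (regarded as a tempered distribution) belongs to $H^{1,r}$, and $$\|f\|_{H^{1,r}}\le \frac{C}{1/s-1/r}\,\|f\|_{X_s}.$$ In particular $X_s$ embeds continuously in $H^{1,r}$. -/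

import Mathlib

open MeasureTheory Set
open scoped ENNReal NNReal SchwartzMap

noncomputable section

namespace HardyLorentz

/-! ### Atomic spaces in a Banach space -/

section Atomic

variable {B : Type*} [NormedAddCommGroup B] [NormedSpace ℂ B]

/-- `φ = ∑ λ_j a_j` (convergence in `B`) with `a_j ∈ 𝒜` and `∑ |λ_j| < ∞`. -/
def IsAtomicDecomposition (𝒜 : Set B) (φ : B) (lam : ℕ → ℂ) (a : ℕ → B) : Prop :=
  (∀ j, a j ∈ 𝒜) ∧ Summable (fun j => ‖lam j‖) ∧ HasSum (fun j => lam j • a j) φ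

/-- The atomic space spanned by `𝒜`. -/
def atomicSpace (𝒜 : Set B) : Set B :=
  {φ | ∃ lam a, IsAtomicDecomposition 𝒜 φ lam a}

/-- The atomic norm `inf ∑ |λ_j|` over all atomic decompositions. It is finite exactly on
`atomicSpace 𝒜`, and equal to `∞` off it. -/
def atomicNorm (𝒜 : Set B) (φ : B) : ℝ≥0∞ :=
  ⨅ (lam : ℕ → ℂ) (a : ℕ → B) (_ : IsAtomicDecomposition 𝒜 φ lam a), ∑' j, ‖lam j‖ₑ

end Atomic

/-! ### The spaces `X_s` -/

/-- The closed cube in `ℝⁿ` with sides parallel to the axes, centre `c`, side length `2 * h`. -/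
def cube {n : ℕ} (c : EuclideanSpace ℝ (Fin n)) (h : ℝ) : Set (EuclideanSpace ℝ (Fin n)) :=
  {x | ∀ i, |x i - c i| ≤ h}

/-- `a` is a `(q,s)` atom with defining cube `Q`: it is supported in `Q`, has vanishing integral,
and `p^{1/s} |Q| (|Q|⁻¹ ∫_Q |a|^q)^{1/q} ≤ 1`, where `p = q / (q - 1)` is the exponent conjugate
to `q`. This is meant for `1 < q ≤ 2` and `0 < s ≤ ∞` (with `1/s = 0` if `s = ∞`). -/
structure IsAtomOn {n : ℕ} (q : ℝ) (s : ℝ≥0∞) (Q : Set (EuclideanSpace ℝ (Fin n)))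
    (a : Lp ℂ 1 (volume : Measure (EuclideanSpace ℝ (Fin n)))) : Prop where
  support : ∀ᵐ x, x ∉ Q → a x = 0
  integral_eq_zero : ∫ x in Q, a x = 0
  size : ENNReal.ofReal (q / (q - 1)) ^ (s⁻¹).toReal * volume Q *
    ((volume Q)⁻¹ * ∫⁻ x in Q, ‖a x‖ₑ ^ q) ^ (1 / q) ≤ 1

/-- The collection `𝒜_s` of all `(q,s)` atoms on `ℝⁿ`, for all `1 < q ≤ 2` and all cubes. -/
def atoms (n : ℕ) (s : ℝ≥0∞) : Set (Lp ℂ 1 (volume : Measure (EuclideanSpace ℝ (Fin n)))) :=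
  {a | ∃ q : ℝ, 1 < q ∧ q ≤ 2 ∧ ∃ c h, 0 < h ∧ IsAtomOn q s (cube c h) a}

/-- The space `X_s(ℝⁿ)`, a subset of `L¹(ℝⁿ)`. -/
def X (n : ℕ) (s : ℝ≥0∞) : Set (Lp ℂ 1 (volume : Measure (EuclideanSpace ℝ (Fin n)))) :=
  atomicSpace (atoms n s)

/-- The norm of `X_s(ℝⁿ)`. -/
def XNorm {n : ℕ} (s : ℝ≥0∞) (f : Lp ℂ 1 (volume : Measure (EuclideanSpace ℝ (Fin n)))) : ℝ≥0∞ :=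
  atomicNorm (atoms n s) f

/-! ### The Lorentz spaces `L^{1,r}` -/

section Lorentz

variable {α : Type*} [MeasurableSpace α]

/-- The non-increasing rearrangement
`g^*(t) = inf {y : μ {g > y} ≤ t}` of a non-negative function. -/
def rearrangement (μ : Measure α) (g : α → ℝ≥0∞) (t : ℝ≥0∞) : ℝ≥0∞ :=
  sInf {y | μ {x | y < g x} ≤ t}

/-- The Lorentz quasi-norm of `L^{1,r}`: `(∫_0^∞ (t g^*(t))^r dt/t)^{1/r}` if `r < ∞`, and
`sup_{t > 0} t g^*(t)` if `r = ∞`. -/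
def lorentzNorm (μ : Measure α) (r : ℝ≥0∞) (g : α → ℝ≥0∞) : ℝ≥0∞ :=
  if r = ∞ then ⨆ (t : ℝ) (_ : 0 < t), ENNReal.ofReal t * rearrangement μ g (ENNReal.ofReal t)
  else (∫⁻ t in Ioi (0 : ℝ),
    (ENNReal.ofReal t * rearrangement μ g (ENNReal.ofReal t)) ^ r.toReal / ENNReal.ofReal t)
      ^ (1 / r.toReal)

/-- Membership of a non-negative function in the Lorentz space `L^{1,r}`. -/
def MemLorentz (μ : Measure α) (r : ℝ≥0∞) (g : α → ℝ≥0∞) : Prop :=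
  AEMeasurable g μ ∧ lorentzNorm μ r g < ∞

end Lorentz

/-! ### The non-tangential maximal function and the Hardy–Lorentz spaces `H^{1,r}` -/

/-- The Schwartz function `z ↦ φ_t(y - z)`, where `φ_t(x) = t⁻ⁿ φ(x / t)`. -/
def dilateReflect {n : ℕ} (φ : 𝓢(EuclideanSpace ℝ (Fin n), ℂ)) (t : ℝ) (ht : 0 < t)
    (y : EuclideanSpace ℝ (Fin n)) : 𝓢(EuclideanSpace ℝ (Fin n), ℂ) :=
  ((t ^ n)⁻¹ : ℂ) • SchwartzMap.compSubConstCLM ℂ y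
    (SchwartzMap.compCLMOfContinuousLinearEquiv ℂ
      (ContinuousLinearEquiv.smulLeft (R₁ := ℝ) (M₁ := EuclideanSpace ℝ (Fin n))
        (-(Units.mk0 t ht.ne')⁻¹)) φ)

theorem dilateReflect_apply {n : ℕ} (φ : 𝓢(EuclideanSpace ℝ (Fin n), ℂ)) (t : ℝ) (ht : 0 < t)
    (y z : EuclideanSpace ℝ (Fin n)) :
    dilateReflect φ t ht y z = ((t ^ n)⁻¹ : ℂ) * φ (t⁻¹ • (y - z)) := by
  have h : (-(Units.mk0 t ht.ne')⁻¹) • (z - y) = t⁻¹ • (y - z) := by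
    rw [Units.smul_def, Units.val_neg, Units.val_inv_eq_inv_val, Units.val_mk0, neg_smul,
      ← smul_neg, neg_sub]
  simp only [dilateReflect, _root_.smul_apply, SchwartzMap.compSubConstCLM_apply, smul_eq_mul]
  rw [← h]
  rfl

/-- The non-tangential maximal function
`N u (x) = sup {|(u * φ_t)(y)| : t > 0, |x - y| < t}` of a tempered distribution `u`, where
`(u * φ_t)(y) = u(φ_t(y - ·))`. -/
def nontangentialMax {n : ℕ} (φ : 𝓢(EuclideanSpace ℝ (Fin n), ℂ))
    (u : 𝓢'(EuclideanSpace ℝ (Fin n), ℂ)) (x : EuclideanSpace ℝ (Fin n)) : ℝ≥0∞ :=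
  ⨆ (t : ℝ) (ht : 0 < t) (y : EuclideanSpace ℝ (Fin n)) (_ : dist x y < t),
    ‖u (dilateReflect φ t ht y)‖ₑ

/-- The quasi-norm of the Hardy–Lorentz space `H^{1,r}(ℝⁿ)`. -/
def hardyLorentzNorm {n : ℕ} (φ : 𝓢(EuclideanSpace ℝ (Fin n), ℂ)) (r : ℝ≥0∞)
    (u : 𝓢'(EuclideanSpace ℝ (Fin n), ℂ)) : ℝ≥0∞ :=
  lorentzNorm volume r (nontangentialMax φ u)

/-- The Hardy–Lorentz space `H^{1,r}(ℝⁿ)`: the tempered distributions whose non-tangential maximal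
function, taken with respect to a Schwartz function `φ` with `∫ φ ≠ 0`, lies in `L^{1,r}`. -/
def H1 {n : ℕ} (φ : 𝓢(EuclideanSpace ℝ (Fin n), ℂ)) (r : ℝ≥0∞) :
    Set (𝓢'(EuclideanSpace ℝ (Fin n), ℂ)) :=
  {u | MemLorentz volume r (nontangentialMax φ u)}

end HardyLorentz

end

/-! The size condition makes an atom small as `q → 1`: with `p = q / (q - 1)`, Jensen's inequality
gives `‖a‖₁ ≤ p ^ (-1/s)`. Its non-tangential maximal function is integrable with a loss of one
factor `p`: `∫ N a ≤ K p · p ^ (-1/s)` (`exists_lintegral_nontangentialMax_le`). Near the cube this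
is a Yano-type estimate, whose constant `1 / (q - 1)` comes from the weak `(q,q)` bound; far from
the cube, `∫ a = 0` supplies the decay.

Atoms are grouped by the `k` with `2 ^ k ≤ p < 2 ^ (k + 1)`. Let `Λ k` be the sum of `|λ_j|` in
group `k`. The maximal function `G k` of the group satisfies a weak `L¹` bound with constant `A k ~
2 ^ (-k/s) Λ k`, by one application of the Hardy-Littlewood theorem to the whole group, and a strong
bound `∫ G k ≤ 2 ^ k A k`. Interpolation gives `‖G k‖_{1,r} ≤ A k · 2 ^ (k/r)`, which is of order `2
^ (-kδ) Λ k` with `δ = 1/s - 1/r`.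

Since `L^{1,r}` has only a quasi-norm, the groups are added by giving `G k` a share `c k` of the
argument of the rearrangement, where `∑ c k ≤ 1`; this costs a factor `1 / c k`
(`lorentzNorm_le_tsum`). With `c k = (δ/2) 2 ^ (-kδ)` the cost uses up exactly the geometric gain,
and `(2/δ) ∑ Λ k` remains. -/

noncomputable section

namespace HardyLorentz

/-! ### Suprema over cones and the maximal function -/

section Cone

variable {E : Type*} [PseudoMetricSpace E]

/-- The supremum over the cone `{(t, y) : dist x y < t}` with vertex `x`. -/
def coneSup (H : ∀ t : ℝ, 0 < t → E → ℝ≥0∞) (x : E) : ℝ≥0∞ :=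
  ⨆ (t : ℝ) (ht : 0 < t) (y : E) (_ : dist x y < t), H t ht y

variable {H K : ∀ t : ℝ, 0 < t → E → ℝ≥0∞} {x : E}

theorem le_coneSup {t : ℝ} (ht : 0 < t) {y : E} (h : dist x y < t) :
    H t ht y ≤ coneSup H x :=
  le_iSup_of_le t <| le_iSup_of_le ht <| le_iSup_of_le y <| le_iSup_of_le h le_rfl

theorem coneSup_le {c : ℝ≥0∞} (h : ∀ t ht y, dist x y < t → H t ht y ≤ c) : coneSup H x ≤ c :=
  iSup_le fun t => iSup_le fun ht => iSup_le fun y => iSup_le fun hy => h t ht y hy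

theorem coneSup_mono (h : ∀ t ht y, H t ht y ≤ K t ht y) (x : E) : coneSup H x ≤ coneSup K x :=
  coneSup_le fun t ht y hy => (h t ht y).trans (le_coneSup ht hy)

theorem lt_coneSup_iff {c : ℝ≥0∞} :
    c < coneSup H x ↔ ∃ t ht y, dist x y < t ∧ c < H t ht y := by
  simp [coneSup, lt_iSup_iff]

/-- The set is a union of balls `ball y t` over the pairs with `c < H t ht y`, so cone suprema are
measurable with no regularity assumed of `H`. -/
theorem isOpen_lt_coneSup (H : ∀ t : ℝ, 0 < t → E → ℝ≥0∞) (c : ℝ≥0∞) :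
    IsOpen {x | c < coneSup H x} := by
  have : {x | c < coneSup H x} =
      ⋃ (t : ℝ) (ht : 0 < t) (y : E) (_ : c < H t ht y), Metric.ball y t := by
    ext x
    simp only [mem_ofPred_eq, lt_coneSup_iff, mem_iUnion, Metric.mem_ball]
    constructor
    · rintro ⟨t, ht, y, h1, h2⟩; exact ⟨t, ht, y, h2, h1⟩
    · rintro ⟨t, ht, y, h1, h2⟩; exact ⟨t, ht, y, h2, h1⟩
  rw [this]
  exact isOpen_iUnion fun t => isOpen_iUnion fun ht => isOpen_iUnion fun y =>
    isOpen_iUnion fun _ => Metric.isOpen_ball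

theorem measurable_coneSup [MeasurableSpace E] [OpensMeasurableSpace E]
    (H : ∀ t : ℝ, 0 < t → E → ℝ≥0∞) : Measurable (coneSup H) :=
  measurable_of_Ioi fun c => (isOpen_lt_coneSup H c).measurableSet

end Cone

/-! ### Weak-type bounds for the uncentred maximal function. -/

section Maximal

set_option linter.unusedSectionVars false

variable {E : Type*} [NormedAddCommGroup E] [NormedSpace ℝ E] [FiniteDimensional ℝ E]
  [MeasurableSpace E] [BorelSpace E] (μ : Measure E) [μ.IsAddHaarMeasure]

/-- The uncentred Hardy-Littlewood maximal function. -/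
def maximalFunction (G : E → ℝ≥0∞) : E → ℝ≥0∞ :=
  coneSup fun t _ y => (μ (Metric.ball y t))⁻¹ * ∫⁻ z in Metric.ball y t, G z ∂μ

theorem lintegral_ball_le_maximalFunction (G : E → ℝ≥0∞) {x y : E} {t : ℝ} (h : dist x y < t) :
    ∫⁻ z in Metric.ball y t, G z ∂μ ≤ μ (Metric.ball y t) * maximalFunction μ G x := by
  have ht : 0 < t := dist_nonneg.trans_lt h
  have h0 : μ (Metric.ball y t) ≠ 0 := (Metric.measure_ball_pos μ y ht).ne'
  have h1 : μ (Metric.ball y t) ≠ ∞ := measure_ball_lt_top.ne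
  calc ∫⁻ z in Metric.ball y t, G z ∂μ
      = μ (Metric.ball y t) * ((μ (Metric.ball y t))⁻¹ * ∫⁻ z in Metric.ball y t, G z ∂μ) := by
        rw [← mul_assoc, ENNReal.mul_inv_cancel h0 h1, one_mul]
    _ ≤ _ := by
        gcongr
        exact le_coneSup (H := fun t _ y => (μ (Metric.ball y t))⁻¹ *
          ∫⁻ z in Metric.ball y t, G z ∂μ) ht h

/-- Vitali covering: disjoint balls on which the average of `G` is at least `c`, enlarged five
times, cover the superlevel set. -/
theorem mul_measure_lt_maximalFunction_le [Nontrivial E] {G : E → ℝ≥0∞} (c : ℝ≥0∞) :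
    c * μ {x | c < maximalFunction μ G x} ≤
      5 ^ Module.finrank ℝ E * ∫⁻ x, G x ∂μ := by
  set d := Module.finrank ℝ E with hd
  have hd0 : d ≠ 0 := Module.finrank_pos.ne'
  by_cases hG : ∫⁻ x, G x ∂μ = ∞
  · rw [hG, ENNReal.mul_top (by positivity)]; exact le_top
  rcases eq_or_ne c 0 with rfl | hc0
  · simp
  rcases eq_or_ne c ∞ with rfl | hct
  · simp
  set ω := μ (Metric.ball (0 : E) 1) with hω
  have hω0 : ω ≠ 0 := (Metric.measure_ball_pos μ 0 one_pos).ne'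
  have hωt : ω ≠ ∞ := measure_ball_lt_top.ne
  let T : Set (E × ℝ) := {p | 0 < p.2 ∧
    c * μ (Metric.ball p.1 p.2) ≤ ∫⁻ z in Metric.ball p.1 p.2, G z ∂μ}
  -- Vitali's lemma needs bounded radii. Here `c ω t ^ d ≤ ∫ G`, and `t ≤ t ^ d` once `t > 1`.
  have hR : ∀ p ∈ T, p.2 ≤ max 1 ((∫⁻ x, G x ∂μ) / (c * ω)).toReal := by
    rintro ⟨y, t⟩ ⟨ht, h⟩
    simp only at ht h ⊢
    rcases le_or_gt t 1 with h1 | h1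
    · exact h1.trans (le_max_left _ _)
    refine le_max_of_le_right ?_
    have h2 : c * (ENNReal.ofReal (t ^ d) * ω) ≤ ∫⁻ x, G x ∂μ := by
      rw [← Measure.addHaar_ball μ y ht.le]
      exact h.trans (setLIntegral_le_lintegral _ _)
    have h3 : ENNReal.ofReal (t ^ d) ≤ (∫⁻ x, G x ∂μ) / (c * ω) := by
      rw [ENNReal.le_div_iff_mul_le (Or.inl (mul_ne_zero hc0 hω0))
        (Or.inl (ENNReal.mul_ne_top hct hωt))]
      calc _ = _ := by ring
        _ ≤ _ := h2
    have h4 := ENNReal.toReal_mono (ENNReal.div_ne_top hG (mul_ne_zero hc0 hω0)) h3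
    rw [ENNReal.toReal_ofReal (by positivity)] at h4
    exact (le_self_pow₀ h1.le hd0).trans h4
  obtain ⟨u, huT, hdisj, hcov⟩ := Vitali.exists_disjoint_subfamily_covering_enlargement_closedBall
    T Prod.fst Prod.snd _ hR 5 (by norm_num)
  have hdisj' : u.PairwiseDisjoint fun p => Metric.ball p.1 p.2 :=
    hdisj.mono fun p => Metric.ball_subset_closedBall
  have hcount : u.Countable := hdisj'.countable_of_isOpen (fun p _ => Metric.isOpen_ball)
    fun p hp => Metric.nonempty_ball.2 (huT hp).1
  have hsub : {x | c < maximalFunction μ G x} ⊆ ⋃ p ∈ u, Metric.closedBall p.1 (5 * p.2) := by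
    intro x hx
    obtain ⟨t, ht, y, hxy, h⟩ := lt_coneSup_iff.1 hx
    have hT : (y, t) ∈ T := by
      refine ⟨ht, ?_⟩
      simp only
      have h0 : μ (Metric.ball y t) ≠ 0 := (Metric.measure_ball_pos μ y ht).ne'
      have h1 : μ (Metric.ball y t) ≠ ∞ := measure_ball_lt_top.ne
      calc c * μ (Metric.ball y t)
          ≤ (μ (Metric.ball y t))⁻¹ * (∫⁻ z in Metric.ball y t, G z ∂μ) * μ (Metric.ball y t) := by
            gcongr
        _ = ∫⁻ z in Metric.ball y t, G z ∂μ := by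
            rw [mul_right_comm, ENNReal.inv_mul_cancel h0 h1, one_mul]
    obtain ⟨p, hp, hsub⟩ := hcov _ hT
    exact mem_biUnion hp (hsub (Metric.mem_closedBall.2 hxy.le))
  have hball : ∀ p ∈ u, c * μ (Metric.closedBall p.1 (5 * p.2)) ≤
      5 ^ d * ∫⁻ z in Metric.ball p.1 p.2, G z ∂μ := by
    intro p hp
    obtain ⟨h0, h1⟩ := huT hp
    calc c * μ (Metric.closedBall p.1 (5 * p.2))
        = 5 ^ d * (c * μ (Metric.ball p.1 p.2)) := by
          rw [Measure.addHaar_closedBall μ _ (by positivity), Measure.addHaar_ball μ _ h0.le,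
            mul_pow, ENNReal.ofReal_mul (by positivity), ENNReal.ofReal_pow (by norm_num)]
          simp only [ENNReal.ofReal_ofNat]
          ring
      _ ≤ _ := by gcongr
  calc c * μ {x | c < maximalFunction μ G x}
      ≤ c * ∑' p : u, μ (Metric.closedBall p.1.1 (5 * p.1.2)) := by
        gcongr
        exact (measure_mono hsub).trans (measure_biUnion_le μ hcount _)
    _ = ∑' p : u, c * μ (Metric.closedBall p.1.1 (5 * p.1.2)) := ENNReal.tsum_mul_left.symm
    _ ≤ ∑' p : u, 5 ^ d * ∫⁻ z in Metric.ball p.1.1 p.1.2, G z ∂μ :=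
        ENNReal.tsum_le_tsum fun p => hball p p.2
    _ = 5 ^ d * ∫⁻ z in ⋃ p ∈ u, Metric.ball p.1 p.2, G z ∂μ := by
        rw [ENNReal.tsum_mul_left, lintegral_biUnion hcount
          (fun p _ => Metric.isOpen_ball.measurableSet) hdisj']
    _ ≤ _ := mul_le_mul_right (setLIntegral_le_lintegral _ _) _

/-- Jensen's inequality for averages. -/
theorem average_le_average_rpow {α : Type*} [MeasurableSpace α] (ν : Measure α) {B : Set α}
    (h0 : ν B ≠ 0) (h1 : ν B ≠ ∞) {G : α → ℝ≥0∞} (hG : Measurable G) {q : ℝ} (hq : 1 < q) :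
    (ν B)⁻¹ * ∫⁻ z in B, G z ∂ν ≤ ((ν B)⁻¹ * ∫⁻ z in B, G z ^ q ∂ν) ^ (1 / q) := by
  have hpq : q.HolderConjugate (q / (q - 1)) := Real.HolderConjugate.conjExponent hq
  have h := ENNReal.lintegral_mul_le_Lp_mul_Lq (ν.restrict B) hpq hG.aemeasurable
    (g := fun _ => 1) aemeasurable_const
  simp only [Pi.mul_apply, mul_one, ENNReal.one_rpow, lintegral_const, Measure.restrict_apply_univ,
    one_mul] at h
  calc (ν B)⁻¹ * ∫⁻ z in B, G z ∂ν
      ≤ (ν B)⁻¹ * ((∫⁻ z in B, G z ^ q ∂ν) ^ (1 / q) * ν B ^ (1 / (q / (q - 1)))) := by gcongr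
    _ = (∫⁻ z in B, G z ^ q ∂ν) ^ (1 / q) * (ν B) ^ (-1 + 1 / (q / (q - 1))) := by
        rw [ENNReal.rpow_add _ _ h0 h1, ENNReal.rpow_neg_one]; ring
    _ = _ := by
        rw [ENNReal.mul_rpow_of_nonneg _ _ (by positivity), ENNReal.inv_rpow, ← ENNReal.rpow_neg,
          mul_comm]
        congr 2
        have := hpq.inv_add_inv_eq_one
        simp only [one_div]
        linarith

/-- By Jensen, the maximal function of `G` to the power `q` is at most that of `G ^ q`, to which the
weak `(1,1)` bound applies. The constant therefore does not depend on `q`. -/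
theorem measure_lt_maximalFunction_le_rpow [Nontrivial E] {G : E → ℝ≥0∞} (hG : Measurable G)
    {q : ℝ} (hq : 1 < q) (c : ℝ≥0∞) :
    c ^ q * μ {x | c < maximalFunction μ G x} ≤
      5 ^ Module.finrank ℝ E * ∫⁻ x, G x ^ q ∂μ := by
  refine le_trans ?_ (mul_measure_lt_maximalFunction_le μ (G := fun x => G x ^ q) (c ^ q))
  refine mul_le_mul_right (measure_mono fun x hx => ?_) _
  obtain ⟨t, ht, y, hxy, h⟩ := lt_coneSup_iff.1 hx
  refine lt_coneSup_iff.2 ⟨t, ht, y, hxy, ?_⟩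
  have h' := h.trans_le (average_le_average_rpow μ (Metric.measure_ball_pos μ y ht).ne'
    measure_ball_lt_top.ne hG hq)
  have := ENNReal.rpow_lt_rpow h' (zero_lt_one.trans hq)
  rwa [← ENNReal.rpow_mul, one_div, inv_mul_cancel₀ (by linarith), ENNReal.rpow_one] at this

/-! ### A model kernel -/

/-- A dyadic model of `w ↦ (1 + ‖w‖) ^ (-(d + 1))`, where `d = dim E`. -/
def dyadicKernel (w : E) : ℝ≥0∞ :=
  ∑' m : ℕ, (2⁻¹ : ℝ≥0∞) ^ ((Module.finrank ℝ E + 1) * m) *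
    (Metric.ball (0 : E) (2 ^ m)).indicator 1 w

theorem measurable_dyadicKernel : Measurable (dyadicKernel (E := E)) :=
  Measurable.tsum fun _ => (measurable_one.indicator
    Metric.isOpen_ball.measurableSet).const_mul _

theorem le_dyadicKernel (w : E) :
    ENNReal.ofReal ((2 * (1 + ‖w‖)) ^ (Module.finrank ℝ E + 1))⁻¹ ≤ dyadicKernel w := by
  obtain ⟨m, h1, h2⟩ := exists_nat_pow_near (x := 1 + ‖w‖) (y := 2)
    (by linarith [norm_nonneg w]) one_lt_two
  refine le_trans ?_ (ENNReal.le_tsum (m + 1))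
  have hw : w ∈ Metric.ball (0 : E) (2 ^ (m + 1)) := by
    rw [mem_ball_zero_iff]; linarith
  rw [indicator_of_mem hw, Pi.one_apply, mul_one]
  have : (2⁻¹ : ℝ≥0∞) ^ ((Module.finrank ℝ E + 1) * (m + 1)) =
      ENNReal.ofReal ((2 ^ (m + 1)) ^ (Module.finrank ℝ E + 1))⁻¹ := by
    rw [ENNReal.ofReal_inv_of_pos (by positivity), ← pow_mul, ENNReal.ofReal_pow (by norm_num),
      ENNReal.inv_pow, mul_comm]
    simp
  rw [this]
  gcongr
  rw [pow_succ]; linarith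

/-- Every ball `ball y (2 ^ m * t)` contains `x`, so its average is controlled at `x`. The weight `2
^ (-(d + 1) m)` beats the volume growth `2 ^ (d m)` by `2 ^ (-m)`, and these sum to `2`. -/
theorem lintegral_dyadicKernel_le [Nontrivial E] {G : E → ℝ≥0∞} (hG : Measurable G) {x y : E}
    {t : ℝ} (h : dist x y < t) :
    ∫⁻ z, G z * (ENNReal.ofReal (t ^ Module.finrank ℝ E)⁻¹ * dyadicKernel (t⁻¹ • (y - z))) ∂μ ≤
      2 * μ (Metric.ball 0 1) * maximalFunction μ G x := by
  set d := Module.finrank ℝ E with hd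
  have ht : 0 < t := dist_nonneg.trans_lt h
  have hterm : ∀ (m : ℕ) (z : E), G z * (ENNReal.ofReal (t ^ d)⁻¹ *
      ((2⁻¹ : ℝ≥0∞) ^ ((d + 1) * m) *
        (Metric.ball (0 : E) (2 ^ m)).indicator 1 (t⁻¹ • (y - z)))) =
      ENNReal.ofReal (t ^ d)⁻¹ * (2⁻¹ : ℝ≥0∞) ^ ((d + 1) * m) *
        (Metric.ball y (2 ^ m * t)).indicator G z := by
    intro m z
    have : t⁻¹ • (y - z) ∈ Metric.ball (0 : E) (2 ^ m) ↔ z ∈ Metric.ball y (2 ^ m * t) := by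
      rw [mem_ball_zero_iff, norm_smul, Metric.mem_ball, dist_eq_norm, norm_sub_rev z y,
        Real.norm_of_nonneg (by positivity), inv_mul_lt_iff₀ ht, mul_comm]
    by_cases hz : z ∈ Metric.ball y (2 ^ m * t)
    · rw [indicator_of_mem hz, indicator_of_mem (this.2 hz), Pi.one_apply]; ring
    · rw [indicator_of_notMem hz, indicator_of_notMem (fun h => hz (this.1 h))]; ring
  calc ∫⁻ z, G z * (ENNReal.ofReal (t ^ d)⁻¹ * dyadicKernel (t⁻¹ • (y - z))) ∂μ
      = ∫⁻ z, ∑' m : ℕ, ENNReal.ofReal (t ^ d)⁻¹ * (2⁻¹ : ℝ≥0∞) ^ ((d + 1) * m) *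
        (Metric.ball y (2 ^ m * t)).indicator G z ∂μ := by
        refine lintegral_congr fun z => ?_
        rw [dyadicKernel, ← ENNReal.tsum_mul_left, ← ENNReal.tsum_mul_left]
        exact tsum_congr fun m => hterm m z
    _ = ∑' m : ℕ, ENNReal.ofReal (t ^ d)⁻¹ * (2⁻¹ : ℝ≥0∞) ^ ((d + 1) * m) *
        ∫⁻ z in Metric.ball y (2 ^ m * t), G z ∂μ := by
        rw [lintegral_tsum fun m => ((hG.indicator
          Metric.isOpen_ball.measurableSet).const_mul _).aemeasurable]
        refine tsum_congr fun m => ?_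
        rw [lintegral_const_mul _ (hG.indicator Metric.isOpen_ball.measurableSet),
          lintegral_indicator Metric.isOpen_ball.measurableSet]
    _ ≤ ∑' m : ℕ, (2⁻¹ : ℝ≥0∞) ^ m * (μ (Metric.ball 0 1) * maximalFunction μ G x) := by
        refine ENNReal.tsum_le_tsum fun m => ?_
        have hb : dist x y < 2 ^ m * t := h.trans_le
          (le_mul_of_one_le_left ht.le (one_le_pow₀ one_le_two))
        have hcst : ENNReal.ofReal (t ^ d)⁻¹ * (2⁻¹ : ℝ≥0∞) ^ ((d + 1) * m) *
            ENNReal.ofReal ((2 ^ m * t) ^ d) = (2⁻¹ : ℝ≥0∞) ^ m := by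
          have e : (2⁻¹ : ℝ≥0∞) = ENNReal.ofReal 2⁻¹ := by
            rw [ENNReal.ofReal_inv_of_pos two_pos]; simp
          rw [e, ← ENNReal.ofReal_pow (by norm_num), ← ENNReal.ofReal_mul (by positivity),
            ← ENNReal.ofReal_mul (by positivity), ← ENNReal.ofReal_pow (by norm_num)]
          congr 1
          have h2 : (2⁻¹ : ℝ) ^ ((d + 1) * m) * (2 ^ m) ^ d = 2⁻¹ ^ m := by
            rw [add_mul, pow_add, one_mul, mul_right_comm, ← pow_mul, mul_comm m d, ← mul_pow]
            norm_num
          rw [mul_pow, ← h2]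
          field_simp
        calc _ ≤ ENNReal.ofReal (t ^ d)⁻¹ * (2⁻¹ : ℝ≥0∞) ^ ((d + 1) * m) *
              (μ (Metric.ball y (2 ^ m * t)) * maximalFunction μ G x) := by
              gcongr
              exact lintegral_ball_le_maximalFunction μ G hb
          _ = ENNReal.ofReal (t ^ d)⁻¹ * (2⁻¹ : ℝ≥0∞) ^ ((d + 1) * m) *
              ENNReal.ofReal ((2 ^ m * t) ^ d) *
              (μ (Metric.ball 0 1) * maximalFunction μ G x) := by
              rw [Measure.addHaar_ball μ y (by positivity)]; ring
          _ = _ := by rw [hcst]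
    _ = _ := by
        rw [ENNReal.tsum_mul_right, ENNReal.tsum_geometric, ENNReal.one_sub_inv_two, inv_inv,
          mul_assoc]

theorem lintegral_dyadicKernel_le_const [Nontrivial E] (y : E) {t : ℝ} (ht : 0 < t) :
    ∫⁻ z, ENNReal.ofReal (t ^ Module.finrank ℝ E)⁻¹ * dyadicKernel (t⁻¹ • (y - z)) ∂μ ≤
      2 * μ (Metric.ball 0 1) := by
  have h := lintegral_dyadicKernel_le μ (G := fun _ => 1) measurable_const (x := y) (y := y)
    (t := t) (by simpa using ht)
  simp only [one_mul] at h
  refine h.trans (mul_le_of_le_one_right' (coneSup_le fun t ht y _ => ?_))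
  rw [lintegral_const, Measure.restrict_apply_univ, one_mul]
  exact ENNReal.inv_mul_le_one _

end Maximal

/-! ### Rearrangements and Lorentz norms -/

section Lorentz

variable {α : Type*} [MeasurableSpace α]

/-- The infimum defining the rearrangement is attained, by continuity of the measure along
increasing sets. -/
theorem measure_rearrangement_lt_le (μ : Measure α) (g : α → ℝ≥0∞) (t : ℝ≥0∞) :
    μ {x | rearrangement μ g t < g x} ≤ t := by
  set S : Set ℝ≥0∞ := {y | μ {x | y < g x} ≤ t} with hS
  have hne : S.Nonempty := ⟨∞, by simp [hS]⟩
  obtain ⟨u, hu, hlim, hmem⟩ := exists_seq_tendsto_sInf hne (OrderBot.bddBelow S)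
  have heq : {x | rearrangement μ g t < g x} = ⋃ k, {x | u k < g x} := by
    ext x
    simp only [mem_ofPred_eq, mem_iUnion]
    constructor
    · intro hx
      exact (hlim.eventually_lt_const hx).exists
    · rintro ⟨k, hk⟩
      exact lt_of_le_of_lt (sInf_le (hmem k)) hk
  have hmono : Monotone fun k => {x | u k < g x} := fun i j hij x hx =>
    lt_of_le_of_lt (hu hij) hx
  rw [heq, hmono.measure_iUnion]
  exact iSup_le hmem

theorem lt_measure_of_lt_rearrangement {μ : Measure α} {g : α → ℝ≥0∞} {t y : ℝ≥0∞}
    (h : y < rearrangement μ g t) : t < μ {x | y < g x} := by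
  by_contra! h'
  exact absurd h (not_lt.2 (sInf_le h'))

theorem antitone_rearrangement (μ : Measure α) (g : α → ℝ≥0∞) :
    Antitone (rearrangement μ g) := fun _ _ h =>
  sInf_le_sInf fun _ hy => le_trans hy h

/-- Outside exceptional sets of measure at most `t k`, each `G k` is at most its rearrangement at `t
k`; the union of these sets has measure at most `T`. -/
theorem rearrangement_le_tsum {μ : Measure α} {g : α → ℝ≥0∞} {G : ℕ → α → ℝ≥0∞}
    (h : ∀ x, g x ≤ ∑' k, G k x) {t : ℕ → ℝ≥0∞} {T : ℝ≥0∞} (ht : ∑' k, t k ≤ T) :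
    rearrangement μ g T ≤ ∑' k, rearrangement μ (G k) (t k) := by
  refine sInf_le ?_
  calc μ {x | ∑' k, rearrangement μ (G k) (t k) < g x}
      ≤ μ (⋃ k, {x | rearrangement μ (G k) (t k) < G k x}) := by
        refine measure_mono fun x hx => ?_
        by_contra hcon
        simp only [mem_iUnion, mem_ofPred_eq, not_exists, not_lt] at hcon
        exact absurd hx (not_lt.2 ((h x).trans (ENNReal.tsum_le_tsum hcon)))
    _ ≤ ∑' k, μ {x | rearrangement μ (G k) (t k) < G k x} := measure_iUnion_le _
    _ ≤ ∑' k, t k := ENNReal.tsum_le_tsum fun k => measure_rearrangement_lt_le _ _ _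
    _ ≤ T := ht

theorem mul_rearrangement_le {μ : Measure α} {g : α → ℝ≥0∞} {A : ℝ≥0∞}
    (h : ∀ y, y * μ {x | y < g x} ≤ A) (t : ℝ≥0∞) : t * rearrangement μ g t ≤ A := by
  rw [mul_comm]
  refine ENNReal.mul_le_of_le_div ?_
  refine le_of_forall_lt_imp_le_of_dense fun y hy => ?_
  have h1 := lt_measure_of_lt_rearrangement hy
  rw [ENNReal.le_div_iff_mul_le (Or.inr ?_) (Or.inl h1.ne_top)]
  · exact (mul_le_mul_right h1.le y).trans (h y)
  -- For `A = 0` the division criterion fails at `t = 0`; instead the hypothesis leaves no room for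
  -- a positive rearrangement.
  · rintro rfl
    have h2 : y * μ {x | y < g x} = 0 := le_antisymm (h y) zero_le
    rcases mul_eq_zero.1 h2 with h3 | h3
    · obtain ⟨z, hz1, hz2⟩ := exists_between hy
      have h5 := lt_measure_of_lt_rearrangement hz2
      have h6 : z * μ {x | z < g x} = 0 := le_antisymm (h z) zero_le
      rcases mul_eq_zero.1 h6 with h7 | h7
      · exact absurd hz1 (by simp [h7])
      · exact absurd h5 (by simp [h7])
    · exact absurd h1 (by simp [h3])

theorem volume_Ioi_inter_ofReal_lt (a : ℝ≥0∞) :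
    volume.restrict (Ioi (0 : ℝ)) {y | ENNReal.ofReal y < a} = a := by
  have hm : MeasurableSet {y : ℝ | ENNReal.ofReal y < a} :=
    measurableSet_lt ENNReal.measurable_ofReal measurable_const
  rw [Measure.restrict_apply hm]
  rcases eq_or_ne a ∞ with rfl | ha
  · simp
  · have : {y : ℝ | ENNReal.ofReal y < a} ∩ Ioi 0 = Ioo 0 a.toReal := by
      ext y
      simp only [mem_inter_iff, mem_ofPred_eq, mem_Ioi, mem_Ioo]
      constructor
      · rintro ⟨h1, h2⟩
        exact ⟨h2, (ENNReal.ofReal_lt_iff_lt_toReal h2.le ha).1 h1⟩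
      · rintro ⟨h1, h2⟩
        exact ⟨(ENNReal.ofReal_lt_iff_lt_toReal h1.le ha).2 h2, h1⟩
    rw [this, Real.volume_Ioo, sub_zero, ENNReal.ofReal_toReal ha]

/-- The layer cake formula for functions with values in `[0, ∞]`. -/
theorem lintegral_eq_lintegral_measure_lt (μ : Measure α) [SFinite μ] {g : α → ℝ≥0∞}
    (hg : Measurable g) :
    ∫⁻ x, g x ∂μ = ∫⁻ y in Ioi (0 : ℝ), μ {x | ENNReal.ofReal y < g x} := by
  have hA : MeasurableSet {p : α × ℝ | ENNReal.ofReal p.2 < g p.1} :=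
    measurableSet_lt (ENNReal.measurable_ofReal.comp measurable_snd) (hg.comp measurable_fst)
  have h1 := Measure.prod_apply (μ := μ) (ν := volume.restrict (Ioi (0 : ℝ))) hA
  rw [Measure.prod_apply_symm hA] at h1
  simp only [preimage_ofPred_eq] at h1
  rw [h1]
  exact lintegral_congr fun x => (volume_Ioi_inter_ofReal_lt _).symm

/-- Layer cake on both sides: if the rearrangement at `c t` exceeds `y`, then `c t < μ {g > y}`. -/
theorem lintegral_rearrangement_le {μ : Measure α} [SFinite μ] {g : α → ℝ≥0∞}
    (hg : Measurable g) {c : ℝ≥0∞} (hc0 : c ≠ 0) (hct : c ≠ ∞) :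
    ∫⁻ t in Ioi (0 : ℝ), rearrangement μ g (c * ENNReal.ofReal t) ≤
      (∫⁻ x, g x ∂μ) / c := by
  have hm : Measurable fun t : ℝ => rearrangement μ g (c * ENNReal.ofReal t) :=
    (antitone_rearrangement μ g).measurable.comp (ENNReal.measurable_ofReal.const_mul c)
  rw [lintegral_eq_lintegral_measure_lt _ hm, lintegral_eq_lintegral_measure_lt _ hg,
    div_eq_mul_inv, ← lintegral_mul_const' _ _ (ENNReal.inv_ne_top.2 hc0)]
  refine lintegral_mono fun y => ?_
  rw [← div_eq_mul_inv, ← volume_Ioi_inter_ofReal_lt (μ {x | ENNReal.ofReal y < g x} / c)]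
  refine measure_mono fun t ht => ?_
  have := lt_measure_of_lt_rearrangement ht
  rw [mul_comm] at this
  exact (ENNReal.lt_div_iff_mul_lt (Or.inl hc0) (Or.inl hct)).2 this

/-- Minkowski's inequality for countable sums. -/
theorem lintegral_rpow_tsum_le {μ : Measure α} {r : ℝ} (hr : 1 ≤ r) {h : ℕ → α → ℝ≥0∞}
    (hh : ∀ k, Measurable (h k)) :
    (∫⁻ x, (∑' k, h k x) ^ r ∂μ) ^ (1 / r) ≤ ∑' k, (∫⁻ x, h k x ^ r ∂μ) ^ (1 / r) := by
  have hr0 : 0 < r := zero_lt_one.trans_le hr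
  have hfin : ∀ m : ℕ, (∫⁻ x, (∑ k ∈ Finset.range m, h k x) ^ r ∂μ) ^ (1 / r) ≤
      ∑ k ∈ Finset.range m, (∫⁻ x, h k x ^ r ∂μ) ^ (1 / r) := by
    intro m
    induction m with
    | zero => simp [hr0]
    | succ m ih =>
      simp only [Finset.sum_range_succ]
      refine (ENNReal.lintegral_Lp_add_le (f := fun x => ∑ k ∈ Finset.range m, h k x)
        (Finset.measurable_fun_sum _ fun k _ => hh k).aemeasurable (hh m).aemeasurable hr).trans ?_
      gcongr
  have hsup : ∫⁻ x, (∑' k, h k x) ^ r ∂μ =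
      ⨆ m : ℕ, ∫⁻ x, (∑ k ∈ Finset.range m, h k x) ^ r ∂μ := by
    rw [← lintegral_iSup]
    · refine lintegral_congr fun x => ?_
      rw [ENNReal.tsum_eq_iSup_nat]
      exact (ENNReal.orderIsoRpow r hr0).map_iSup _
    · intro m
      exact (Finset.measurable_fun_sum _ fun k _ => hh k).pow_const r
    · intro i j hij x
      refine ENNReal.rpow_le_rpow ?_ hr0.le
      exact Finset.sum_le_sum_of_subset (Finset.range_mono hij)
  rw [one_div, ENNReal.rpow_inv_le_iff hr0, hsup]
  refine iSup_le fun m => ?_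
  rw [← ENNReal.rpow_inv_le_iff hr0, ← one_div]
  exact (hfin m).trans (ENNReal.sum_le_tsum _)

/-- With `ρ` the rearrangement at `c t`, write `(t ρ) ^ r / t = (t ρ) ^ (r - 1) ρ`. The weak bound
controls the first factor by `(A / c) ^ (r - 1)`, and the strong bound integrates the second. -/
theorem lintegral_mul_rearrangement_rpow_le {μ : Measure α} [SFinite μ] {g : α → ℝ≥0∞}
    (hg : Measurable g) {r : ℝ} (hr : 1 ≤ r) {c A N : ℝ≥0∞} (hc0 : c ≠ 0) (hct : c ≠ ∞)
    (hweak : ∀ y, y * μ {x | y < g x} ≤ A) (hstrong : ∫⁻ x, g x ∂μ ≤ N * A) :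
    (∫⁻ t in Ioi (0 : ℝ), (ENNReal.ofReal t *
      rearrangement μ g (c * ENNReal.ofReal t)) ^ r / ENNReal.ofReal t) ^ (1 / r) ≤
      A / c * N ^ r⁻¹ := by
  have hr0 : 0 < r := zero_lt_one.trans_le hr
  have hpt : ∀ t ∈ Ioi (0 : ℝ), (ENNReal.ofReal t *
      rearrangement μ g (c * ENNReal.ofReal t)) ^ r / ENNReal.ofReal t ≤
      (A / c) ^ (r - 1) * rearrangement μ g (c * ENNReal.ofReal t) := by
    intro t ht
    have ht0 : ENNReal.ofReal t ≠ 0 := (ENNReal.ofReal_pos.2 ht).ne'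
    set ρ := rearrangement μ g (c * ENNReal.ofReal t)
    have h1 : ENNReal.ofReal t * ρ ≤ A / c := by
      rw [ENNReal.le_div_iff_mul_le (Or.inl hc0) (Or.inl hct)]
      calc _ = c * ENNReal.ofReal t * ρ := by ring
        _ ≤ A := mul_rearrangement_le hweak _
    calc (ENNReal.ofReal t * ρ) ^ r / ENNReal.ofReal t
        = (ENNReal.ofReal t * ρ) ^ (r - 1) * (ENNReal.ofReal t * ρ) / ENNReal.ofReal t := by
          congr 1
          conv_lhs => rw [← sub_add_cancel r 1,
            ENNReal.rpow_add_of_nonneg _ _ (sub_nonneg.2 hr) zero_le_one, ENNReal.rpow_one]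
      _ = (ENNReal.ofReal t * ρ) ^ (r - 1) * ρ := by
          rw [mul_div_assoc, ENNReal.mul_div_right_comm, ENNReal.div_self ht0 ENNReal.ofReal_ne_top,
            one_mul]
      _ ≤ _ := by
          have := sub_nonneg.2 hr
          gcongr
  have hm : Measurable fun t : ℝ => rearrangement μ g (c * ENNReal.ofReal t) :=
    (antitone_rearrangement μ g).measurable.comp (ENNReal.measurable_ofReal.const_mul c)
  rw [one_div, ENNReal.rpow_inv_le_iff hr0]
  calc _ ≤ ∫⁻ t in Ioi (0 : ℝ), (A / c) ^ (r - 1) *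
        rearrangement μ g (c * ENNReal.ofReal t) := setLIntegral_mono' measurableSet_Ioi hpt
    _ ≤ (A / c) ^ (r - 1) * (N * A / c) := by
        rw [lintegral_const_mul _ hm]
        gcongr
        refine (lintegral_rearrangement_le hg hc0 hct).trans ?_
        gcongr
    _ = (A / c) ^ (r - 1) * (A / c) ^ (1 : ℝ) * N := by
        rw [ENNReal.rpow_one, mul_div_assoc]; ring
    _ = (A / c * N ^ r⁻¹) ^ r := by
        rw [← ENNReal.rpow_add_of_nonneg _ _ (sub_nonneg.2 hr) zero_le_one, sub_add_cancel,
          ENNReal.mul_rpow_of_nonneg _ _ hr0.le, ← ENNReal.rpow_mul, inv_mul_cancel₀ hr0.ne',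
          ENNReal.rpow_one]

/-- A function dominated by a series whose terms obey weak and strong `L¹` bounds obeys the
Lorentz bound obtained by summing the interpolated bounds with weights. -/
theorem lorentzNorm_le_tsum {μ : Measure α} [SFinite μ] {r : ℝ≥0∞} (hr : 1 ≤ r) {g : α → ℝ≥0∞}
    {G : ℕ → α → ℝ≥0∞} (h : ∀ x, g x ≤ ∑' k, G k x) (hG : ∀ k, Measurable (G k))
    {c A N : ℕ → ℝ≥0∞} (hc0 : ∀ k, c k ≠ 0) (hc : ∑' k, c k ≤ 1)
    (hweak : ∀ k y, y * μ {x | y < G k x} ≤ A k)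
    (hstrong : ∀ k, ∫⁻ x, G k x ∂μ ≤ N k * A k) :
    lorentzNorm μ r g ≤ ∑' k, A k / c k * N k ^ (r⁻¹).toReal := by
  have hct : ∀ k, c k ≠ ∞ := fun k =>
    ((ENNReal.le_tsum k).trans hc).trans_lt ENNReal.one_lt_top |>.ne
  have hrearr : ∀ t : ℝ≥0∞, t * rearrangement μ g t ≤
      ∑' k, t * rearrangement μ (G k) (c k * t) := by
    intro t
    rw [ENNReal.tsum_mul_left]
    gcongr
    refine rearrangement_le_tsum h ?_
    rw [ENNReal.tsum_mul_right]
    exact mul_le_of_le_one_left' hc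
  rw [lorentzNorm]
  split_ifs with hrt
  · subst hrt
    refine iSup_le fun t => iSup_le fun _ => (hrearr _).trans (ENNReal.tsum_le_tsum fun k => ?_)
    -- For `r = ∞` the exponent of `N k` is `0`, so the weak bound alone suffices.
    simp only [ENNReal.inv_top, ENNReal.toReal_zero, ENNReal.rpow_zero, mul_one]
    rw [ENNReal.le_div_iff_mul_le (Or.inl (hc0 k)) (Or.inl (hct k))]
    calc _ = c k * ENNReal.ofReal t * rearrangement μ (G k) (c k * ENNReal.ofReal t) := by ring
      _ ≤ A k := mul_rearrangement_le (hweak k) _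
  · have hr1 : 1 ≤ r.toReal := by
      simpa using ENNReal.toReal_mono hrt hr
    have hr0 : 0 < r.toReal := zero_lt_one.trans_le hr1
    -- Moves the density `1 / t` inside the power, so that Minkowski's inequality applies with
    -- Lebesgue measure.
    have hw : ∀ t u : ℝ≥0∞, (u * t ^ (-(r.toReal)⁻¹)) ^ r.toReal = u ^ r.toReal / t := by
      intro t u
      rw [ENNReal.mul_rpow_of_nonneg _ _ hr0.le, ← ENNReal.rpow_mul, neg_mul,
        inv_mul_cancel₀ hr0.ne', ENNReal.rpow_neg_one, div_eq_mul_inv]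
    have hm : ∀ k, Measurable fun t : ℝ => ENNReal.ofReal t *
        rearrangement μ (G k) (c k * ENNReal.ofReal t) *
          ENNReal.ofReal t ^ (-(r.toReal)⁻¹) := fun k =>
      (ENNReal.measurable_ofReal.mul ((antitone_rearrangement μ (G k)).measurable.comp
        (ENNReal.measurable_ofReal.const_mul _))).mul (ENNReal.measurable_ofReal.pow_const _)
    calc _ ≤ (∫⁻ t in Ioi (0 : ℝ), (∑' k, ENNReal.ofReal t *
          rearrangement μ (G k) (c k * ENNReal.ofReal t) *
          ENNReal.ofReal t ^ (-(r.toReal)⁻¹)) ^ r.toReal) ^ (1 / r.toReal) := by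
          gcongr with t
          rw [ENNReal.tsum_mul_right, hw]
          gcongr
          exact hrearr _
      _ ≤ _ := lintegral_rpow_tsum_le hr1 hm
      _ ≤ _ := by
          refine ENNReal.tsum_le_tsum fun k => ?_
          simp only [hw, ENNReal.toReal_inv]
          exact lintegral_mul_rearrangement_rpow_le (hG k) hr1 (hc0 k) (hct k) (hweak k)
            (hstrong k)

end Lorentz

/-! ### Estimates for atoms -/

section Schwartz

variable {E : Type*} [NormedAddCommGroup E] [NormedSpace ℝ E]

theorem exists_schwartz_decay (φ : 𝓢(E, ℂ)) (k : ℕ) : ∃ C : ℝ, 0 ≤ C ∧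
    ∀ w, ‖φ w‖ ≤ C * ((1 + ‖w‖) ^ k)⁻¹ ∧ ‖fderiv ℝ φ w‖ ≤ C * ((1 + ‖w‖) ^ k)⁻¹ := by
  set C := 2 ^ k * (Finset.Iic (k, 1)).sup (fun m => SchwartzMap.seminorm ℝ m.1 m.2) φ
  refine ⟨C, mul_nonneg (by positivity) (apply_nonneg _ _), fun w => ?_⟩
  have hw : 0 < (1 + ‖w‖) ^ k := by positivity
  have h0 := SchwartzMap.one_add_le_sup_seminorm_apply (𝕜 := ℝ) (m := (k, 1)) (k := k) (n := 0)
    le_rfl zero_le_one φ w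
  have h1 := SchwartzMap.one_add_le_sup_seminorm_apply (𝕜 := ℝ) (m := (k, 1)) (k := k) (n := 1)
    le_rfl le_rfl φ w
  rw [norm_iteratedFDeriv_zero] at h0
  rw [norm_iteratedFDeriv_one] at h1
  rw [← div_eq_mul_inv, le_div_iff₀ hw, le_div_iff₀ hw, mul_comm, mul_comm ‖fderiv ℝ φ w‖]
  exact ⟨h0, h1⟩

end Schwartz

section Atoms

variable {n : ℕ} {φ : 𝓢(EuclideanSpace ℝ (Fin n), ℂ)} {C : ℝ}

theorem enorm_apply_dilateReflect_le (hC : 0 ≤ C)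
    (hφ : ∀ w, ‖φ w‖ ≤ C * ((1 + ‖w‖) ^ (n + 1))⁻¹)
    (a : Lp ℂ 1 (volume : Measure (EuclideanSpace ℝ (Fin n)))) (t : ℝ) (ht : 0 < t)
    (y : EuclideanSpace ℝ (Fin n)) :
    ‖Lp.toTemperedDistribution a (dilateReflect φ t ht y)‖ₑ ≤ ENNReal.ofReal (C * 2 ^ (n + 1)) *
      ∫⁻ z, ‖a z‖ₑ * (ENNReal.ofReal (t ^ Module.finrank ℝ (EuclideanSpace ℝ (Fin n)))⁻¹ *
        dyadicKernel (t⁻¹ • (y - z))) := by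
  rw [Lp.toTemperedDistribution_apply]
  refine (enorm_integral_le_lintegral_enorm _).trans ?_
  rw [← lintegral_const_mul' _ _ ENNReal.ofReal_ne_top]
  refine lintegral_mono fun z => ?_
  rw [enorm_smul, dilateReflect_apply, enorm_mul]
  set w := t⁻¹ • (y - z)
  have h1 : ‖((t ^ n)⁻¹ : ℂ)‖ₑ =
      ENNReal.ofReal (t ^ Module.finrank ℝ (EuclideanSpace ℝ (Fin n)))⁻¹ := by
    rw [← ofReal_norm, finrank_euclideanSpace_fin, norm_inv, norm_pow, Complex.norm_real,
      Real.norm_of_nonneg ht.le]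
  have h2 : ‖φ w‖ₑ ≤ ENNReal.ofReal (C * 2 ^ (n + 1)) * dyadicKernel w := by
    refine le_trans ?_ (mul_le_mul_right (le_dyadicKernel w) _)
    rw [← ENNReal.ofReal_mul (by positivity), ← ofReal_norm, finrank_euclideanSpace_fin]
    refine ENNReal.ofReal_le_ofReal ((hφ w).trans (le_of_eq ?_))
    rw [mul_pow]
    have := norm_nonneg w
    field_simp
  rw [h1]
  calc _ ≤ _ := mul_le_mul_left (mul_le_mul_right h2 _) _
    _ = _ := by ring

theorem coneSup_lintegral_le_maximalFunction [Nontrivial (EuclideanSpace ℝ (Fin n))] {C : ℝ≥0∞}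
    {G : EuclideanSpace ℝ (Fin n) → ℝ≥0∞} (hG : Measurable G)
    (x : EuclideanSpace ℝ (Fin n)) :
    coneSup (fun t _ y => C * ∫⁻ z, G z *
      (ENNReal.ofReal (t ^ Module.finrank ℝ (EuclideanSpace ℝ (Fin n)))⁻¹ *
        dyadicKernel (t⁻¹ • (y - z)))) x ≤
      C * (2 * volume (Metric.ball (0 : EuclideanSpace ℝ (Fin n)) 1)) *
        maximalFunction volume G x := by
  refine coneSup_le fun t ht y hxy => ?_
  rw [mul_assoc]
  gcongr
  exact lintegral_dyadicKernel_le volume hG hxy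

/-- Because `∫ a = 0`, the test function `ψ` may be replaced by `ψ - ψ c`, which the mean value
inequality bounds on the ball by a multiple of `R / D ^ (n + 1)`. This is independent of `t` and
comparable to an integrable kernel at scale `R`. -/
theorem enorm_apply_dilateReflect_le_of_far (hC : 0 ≤ C)
    (hφ : ∀ w, ‖fderiv ℝ φ w‖ ≤ C * ((1 + ‖w‖) ^ (n + 1))⁻¹)
    {a : Lp ℂ 1 (volume : Measure (EuclideanSpace ℝ (Fin n)))}
    {c : EuclideanSpace ℝ (Fin n)} {R : ℝ} (hR : 0 < R)
    (hsupp : ∀ᵐ z, z ∉ Metric.closedBall c R → a z = 0) (hint : ∫ z, a z = 0)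
    {x y : EuclideanSpace ℝ (Fin n)} (hx : 2 * R ≤ dist x c) {t : ℝ} (ht : 0 < t)
    (hxy : dist x y < t) :
    ‖Lp.toTemperedDistribution a (dilateReflect φ t ht y)‖ₑ ≤ ENNReal.ofReal (C * 8 ^ (n + 1)) *
      (∫⁻ z, ‖a z‖ₑ) * (ENNReal.ofReal (R ^ Module.finrank ℝ (EuclideanSpace ℝ (Fin n)))⁻¹ *
        dyadicKernel (R⁻¹ • (c - x))) := by
  set ψ := dilateReflect φ t ht y with hψ
  set D := dist x c with hD
  have hD0 : 0 < D := by linarith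
  have hone : ENNReal.ofReal (C * 2 ^ (n + 1) * (R / D ^ (n + 1))) ≤
      ENNReal.ofReal (C * 8 ^ (n + 1)) *
      (ENNReal.ofReal (R ^ Module.finrank ℝ (EuclideanSpace ℝ (Fin n)))⁻¹ *
        dyadicKernel (R⁻¹ • (c - x))) := by
    refine le_trans ?_ (mul_le_mul_right (mul_le_mul_right (le_dyadicKernel _) _) _)
    rw [finrank_euclideanSpace_fin, ← ENNReal.ofReal_mul (by positivity),
      ← ENNReal.ofReal_mul (by positivity)]
    refine ENNReal.ofReal_le_ofReal ?_
    have hn : ‖R⁻¹ • (c - x)‖ = D / R := by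
      rw [norm_smul, Real.norm_of_nonneg (by positivity), hD, dist_comm, dist_eq_norm]
      ring
    have h1 : R / D ^ (n + 1) ≤ 4 ^ (n + 1) * ((R ^ n)⁻¹ * ((2 * (1 + D / R)) ^ (n + 1))⁻¹) := by
      have e : (R ^ n)⁻¹ * ((2 * (1 + D / R)) ^ (n + 1))⁻¹ = R / (2 * (R + D)) ^ (n + 1) := by
        have : 2 * (1 + D / R) = 2 * (R + D) / R := by field_simp
        rw [this, div_pow, pow_succ R]
        field_simp
      rw [e, mul_div_assoc', div_le_div_iff₀ (by positivity) (by positivity)]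
      have h2 : (2 * (R + D)) ^ (n + 1) ≤ D ^ (n + 1) * 4 ^ (n + 1) := by
        rw [← mul_pow]
        exact pow_le_pow_left₀ (by positivity) (by linarith) _
      calc _ ≤ R * (D ^ (n + 1) * 4 ^ (n + 1)) := by gcongr
        _ = _ := by ring
    rw [hn]
    have e8 : (8 : ℝ) ^ (n + 1) = 2 ^ (n + 1) * 4 ^ (n + 1) := by rw [← mul_pow]; norm_num
    calc _ ≤ C * 2 ^ (n + 1) *
          (4 ^ (n + 1) * ((R ^ n)⁻¹ * ((2 * (1 + D / R)) ^ (n + 1))⁻¹)) := by gcongr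
      _ = _ := by rw [e8]; ring
  have hosc : ∀ z ∈ Metric.closedBall c R, ‖ψ z - ψ c‖ ≤ C * 2 ^ (n + 1) * (R / D ^ (n + 1)) := by
    intro z hz
    set S := Metric.closedBall (t⁻¹ • (y - c)) (R / t) with hS
    have hzS : t⁻¹ • (y - z) ∈ S := by
      rw [hS, Metric.mem_closedBall, dist_eq_norm, ← smul_sub, sub_sub_sub_cancel_left, norm_smul,
        Real.norm_of_nonneg (by positivity), div_eq_inv_mul]
      rw [Metric.mem_closedBall, dist_comm, dist_eq_norm] at hz
      gcongr
    have hcS : t⁻¹ • (y - c) ∈ S := Metric.mem_closedBall_self (by positivity)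
    -- From `D ≤ t + dist y c ≤ t + t ‖w‖ + R` and `R ≤ D / 2` one gets `D ≤ 2 t (1 + ‖w‖)`. The
    -- powers of `t` then cancel against `t ^ (-n)` and the radius `R / t`.
    have hder : ∀ w ∈ S, ‖fderiv ℝ φ w‖ ≤ C * (2 * t / D) ^ (n + 1) := by
      intro w hw
      refine (hφ w).trans ?_
      rw [← inv_pow]
      gcongr
      rw [inv_le_comm₀ (by positivity) (by positivity), inv_div, div_le_iff₀ (by positivity)]
      have h1 : ‖t⁻¹ • (y - c)‖ ≤ ‖w‖ + R / t := by
        have := Metric.mem_closedBall.1 hw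
        rw [dist_comm, dist_eq_norm] at this
        linarith [norm_le_insert' (t⁻¹ • (y - c)) w]
      rw [norm_smul, Real.norm_of_nonneg (by positivity), ← dist_eq_norm] at h1
      have h2 : D ≤ t + dist y c := (dist_triangle x y c).trans (by linarith)
      have h3 : dist y c ≤ t * ‖w‖ + R := by
        have := mul_le_mul_of_nonneg_left h1 ht.le
        rw [mul_inv_cancel_left₀ ht.ne', mul_add, mul_div_cancel₀ _ ht.ne'] at this
        exact this
      linarith
    have h := (convex_closedBall _ _).norm_image_sub_le_of_norm_fderiv_le (𝕜 := ℝ)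
      (fun w _ => φ.differentiableAt) hder hcS hzS
    rw [← dist_eq_norm (t⁻¹ • (y - z))] at h
    rw [hψ, dilateReflect_apply, dilateReflect_apply, ← mul_sub, norm_mul, norm_inv, norm_pow,
      Complex.norm_real, Real.norm_of_nonneg ht.le]
    calc _ ≤ (t ^ n)⁻¹ * (C * (2 * t / D) ^ (n + 1) * (R / t)) := by
          gcongr
          exact h.trans (by gcongr; exact hzS)
      _ = _ := by
          rw [div_pow, mul_pow, pow_succ t]
          field_simp
  have ha : Integrable (a : EuclideanSpace ℝ (Fin n) → ℂ) := L1.integrable_coeFn a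
  have hψa : Integrable fun z => ψ z • a z := by
    obtain ⟨B, hB⟩ := ψ.decay 0 0
    refine ha.bdd_mul (c := B) ψ.continuous.aestronglyMeasurable (Filter.Eventually.of_forall ?_)
    intro z
    simpa using hB.2 z
  have heq : Lp.toTemperedDistribution a ψ = ∫ z, (ψ z - ψ c) • a z := by
    simp only [sub_smul]
    rw [integral_sub hψa (ha.fun_smul (ψ c)), integral_smul, hint, smul_zero, sub_zero,
      Lp.toTemperedDistribution_apply]
  rw [heq]
  refine (enorm_integral_le_lintegral_enorm _).trans ?_
  calc ∫⁻ z, ‖(ψ z - ψ c) • a z‖ₑ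
      ≤ ∫⁻ z, ENNReal.ofReal (C * 2 ^ (n + 1) * (R / D ^ (n + 1))) * ‖a z‖ₑ := by
        refine lintegral_mono_ae ?_
        filter_upwards [hsupp] with z hz
        by_cases hzc : z ∈ Metric.closedBall c R
        · rw [enorm_smul]
          gcongr
          rw [← ofReal_norm]
          exact ENNReal.ofReal_le_ofReal (hosc z hzc)
        · simp [hz hzc]
    _ = ENNReal.ofReal (C * 2 ^ (n + 1) * (R / D ^ (n + 1))) * ∫⁻ z, ‖a z‖ₑ :=
        lintegral_const_mul' _ _ ENNReal.ofReal_ne_top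
    _ ≤ _ := (mul_le_mul_left hone _).trans (le_of_eq (by ring))

/-- A Yano-type estimate for the maximal function, with the sharp constant as `q → 1`. -/
theorem setLIntegral_maximalFunction_le {E : Type*} [NormedAddCommGroup E] [NormedSpace ℝ E]
    [FiniteDimensional ℝ E] [MeasurableSpace E] [BorelSpace E] (μ : Measure E)
    [μ.IsAddHaarMeasure] [Nontrivial E] {G : E → ℝ≥0∞} (hG : Measurable G) {q : ℝ} (hq : 1 < q)
    {b : ℝ} (hb : 0 < b) {V : ℝ≥0∞} (hV : ∫⁻ x, G x ^ q ∂μ ≤ V * ENNReal.ofReal b ^ q)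
    (S : Set E) :
    ∫⁻ x in S, maximalFunction μ G x ∂μ ≤ ENNReal.ofReal b * μ S +
      5 ^ Module.finrank ℝ E * (V * ENNReal.ofReal b) * ENNReal.ofReal (q - 1)⁻¹ := by
  have hmeas : Measurable (maximalFunction μ G) := measurable_coneSup _
  -- Below height `b` the superlevel sets are bounded by `μ S`; above it the weak `(q,q)` bound
  -- leaves `∫_b^∞ y ^ (-q) dy = b ^ (1 - q) / (q - 1)`.
  rw [lintegral_eq_lintegral_measure_lt _ hmeas, ← Ioc_union_Ioi_eq_Ioi hb.le]
  refine (lintegral_union_le _ _ _).trans (add_le_add ?_ ?_)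
  · calc _ ≤ ∫⁻ _ in Ioc 0 b, μ S := by
          refine lintegral_mono fun y => ?_
          exact (measure_mono (subset_univ _)).trans (by simp)
      _ = _ := by rw [setLIntegral_const, Real.volume_Ioc, sub_zero, mul_comm]
  · have hint : ∫⁻ y in Ioi b, ENNReal.ofReal (y ^ (-q)) =
        ENNReal.ofReal (b ^ (1 - q) * (q - 1)⁻¹) := by
      rw [← ofReal_integral_eq_lintegral_ofReal (integrableOn_Ioi_rpow_of_lt (by linarith) hb),
        integral_Ioi_rpow_of_lt (by linarith) hb]
      · congr 1
        rw [neg_add_eq_sub, ← neg_sub q 1, div_neg, neg_div, neg_neg, div_eq_mul_inv]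
      · filter_upwards [ae_restrict_mem measurableSet_Ioi] with y hy
        exact Real.rpow_nonneg (hb.trans hy).le _
    calc _ ≤ ∫⁻ y in Ioi b, 5 ^ Module.finrank ℝ E * (V * ENNReal.ofReal b ^ q) *
          ENNReal.ofReal (y ^ (-q)) := by
          refine setLIntegral_mono' measurableSet_Ioi fun y hy => ?_
          have hy0 : 0 < y := hb.trans hy
          rw [Real.rpow_neg hy0.le, ENNReal.ofReal_inv_of_pos (Real.rpow_pos_of_pos hy0 _),
            ← ENNReal.ofReal_rpow_of_pos hy0, ← div_eq_mul_inv,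
            ENNReal.le_div_iff_mul_le (Or.inl (by
              rw [ENNReal.ofReal_rpow_of_pos hy0]
              exact (ENNReal.ofReal_pos.2 (Real.rpow_pos_of_pos hy0 _)).ne'))
              (Or.inl (ENNReal.rpow_ne_top_of_nonneg (by linarith) ENNReal.ofReal_ne_top)),
            mul_comm]
          calc _ ≤ ENNReal.ofReal y ^ q * μ {x | ENNReal.ofReal y < maximalFunction μ G x} := by
                exact mul_le_mul_right (Measure.restrict_apply_le _ _) _
            _ ≤ _ := measure_lt_maximalFunction_le_rpow μ hG hq _
            _ ≤ _ := by gcongr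
      _ = 5 ^ Module.finrank ℝ E * (V * ENNReal.ofReal b ^ q) *
          ENNReal.ofReal (b ^ (1 - q) * (q - 1)⁻¹) := by
          rw [lintegral_const_mul _ (by fun_prop), hint]
      _ = 5 ^ Module.finrank ℝ E * V * (ENNReal.ofReal b ^ q *
          ENNReal.ofReal (b ^ (1 - q) * (q - 1)⁻¹)) := by ring
      _ = 5 ^ Module.finrank ℝ E * V * (ENNReal.ofReal b * ENNReal.ofReal (q - 1)⁻¹) := by
          rw [ENNReal.ofReal_rpow_of_pos hb, ← ENNReal.ofReal_mul (by positivity),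
            ← ENNReal.ofReal_mul hb.le, ← mul_assoc, ← Real.rpow_add hb, add_sub_cancel,
            Real.rpow_one]
      _ ≤ _ := le_of_eq (by ring)

/-! ### Comparison of cubes and balls. -/

theorem cube_subset_closedBall (c : EuclideanSpace ℝ (Fin n)) {h : ℝ} (hh : 0 ≤ h) :
    cube c h ⊆ Metric.closedBall c (√n * h) := by
  intro x hx
  rw [Metric.mem_closedBall, EuclideanSpace.dist_eq]
  calc _ ≤ √(∑ _ : Fin n, h ^ 2) := by
        gcongr with i
        rw [Real.dist_eq]; exact hx i
    _ = _ := by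
        rw [Finset.sum_const, Finset.card_univ, Fintype.card_fin, nsmul_eq_mul,
          Real.sqrt_mul (by positivity), Real.sqrt_sq hh]

theorem ball_subset_cube (c : EuclideanSpace ℝ (Fin n)) (h : ℝ) : Metric.ball c h ⊆ cube c h := by
  intro x hx i
  rw [Metric.mem_ball, dist_eq_norm] at hx
  have := PiLp.norm_apply_le (x - c) i
  rw [PiLp.sub_apply, Real.norm_eq_abs] at this
  exact this.trans hx.le

theorem isClosed_cube (c : EuclideanSpace ℝ (Fin n)) (h : ℝ) : IsClosed (cube c h) := by
  have : cube c h = ⋂ i, {x | |x i - c i| ≤ h} := by ext; simp [cube]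
  rw [this]
  exact isClosed_iInter fun i => isClosed_le (by fun_prop) continuous_const

theorem volume_closedBall_le_volume_cube (c : EuclideanSpace ℝ (Fin n)) {h D : ℝ} (hh : 0 < h)
    (hD : 0 ≤ D) :
    volume (Metric.closedBall c (D * h)) ≤ ENNReal.ofReal (D ^ n) * volume (cube c h) := by
  refine le_trans (le_of_eq ?_) (mul_le_mul_right (measure_mono (ball_subset_cube c h)) _)
  rw [Measure.addHaar_closedBall _ _ (by positivity), Measure.addHaar_ball_of_pos _ _ hh,
    finrank_euclideanSpace_fin, mul_pow, ENNReal.ofReal_mul (by positivity), mul_assoc]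

theorem volume_cube_ne_zero (c : EuclideanSpace ℝ (Fin n)) {h : ℝ} (hh : 0 < h) :
    volume (cube c h) ≠ 0 :=
  ((Metric.measure_ball_pos volume c hh).trans_le (measure_mono (ball_subset_cube c h))).ne'

theorem volume_cube_ne_top (c : EuclideanSpace ℝ (Fin n)) {h : ℝ} (hh : 0 < h) :
    volume (cube c h) ≠ ∞ :=
  ((measure_mono (cube_subset_closedBall c hh.le)).trans_lt measure_closedBall_lt_top).ne

theorem measurable_enorm_coeFn (a : Lp ℂ 1 (volume : Measure (EuclideanSpace ℝ (Fin n)))) :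
    Measurable fun x => ‖a x‖ₑ :=
  (Lp.stronglyMeasurable a).enorm

/-! ### Integral bounds for a single atom. -/

namespace IsAtomOn

variable {q : ℝ} {s : ℝ≥0∞} {c : EuclideanSpace ℝ (Fin n)} {h : ℝ}
  {a : Lp ℂ 1 (volume : Measure (EuclideanSpace ℝ (Fin n)))}

theorem setLIntegral_eq (ha : IsAtomOn q s (cube c h) a) {F : ℝ≥0∞ → ℝ≥0∞} (hF : F 0 = 0) :
    ∫⁻ x in cube c h, F ‖a x‖ₑ = ∫⁻ x, F ‖a x‖ₑ := by
  rw [← lintegral_indicator (isClosed_cube c h).measurableSet]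
  refine lintegral_congr_ae ?_
  filter_upwards [ha.support] with x hx
  by_cases hxc : x ∈ cube c h
  · rw [indicator_of_mem hxc]
  · rw [indicator_of_notMem hxc, hx hxc, enorm_zero, hF]

theorem volume_mul_average_le (hq : 1 < q) (ha : IsAtomOn q s (cube c h) a) :
    volume (cube c h) * ((volume (cube c h))⁻¹ * ∫⁻ x in cube c h, ‖a x‖ₑ ^ q) ^ (1 / q) ≤
      ENNReal.ofReal (q / (q - 1)) ^ (-(s⁻¹).toReal) := by
  have hp : 0 < q / (q - 1) := div_pos (by linarith) (by linarith)
  rw [ENNReal.rpow_neg, ← one_div (ENNReal.ofReal _ ^ _), ENNReal.le_div_iff_mul_le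
    (Or.inl (by rw [ENNReal.ofReal_rpow_of_pos hp]
                exact (ENNReal.ofReal_pos.2 (Real.rpow_pos_of_pos hp _)).ne'))
    (Or.inl (ENNReal.rpow_ne_top_of_nonneg ENNReal.toReal_nonneg ENNReal.ofReal_ne_top))]
  exact (le_of_eq (by ring)).trans ha.size

theorem lintegral_enorm_le (hh : 0 < h) (hq : 1 < q) (ha : IsAtomOn q s (cube c h) a) :
    ∫⁻ x, ‖a x‖ₑ ≤ ENNReal.ofReal (q / (q - 1)) ^ (-(s⁻¹).toReal) := by
  have h0 := volume_cube_ne_zero c hh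
  have h1 := volume_cube_ne_top c hh
  have h2 := ha.setLIntegral_eq (F := id) rfl
  simp only [id] at h2
  rw [← h2]
  calc _ = volume (cube c h) * ((volume (cube c h))⁻¹ * ∫⁻ x in cube c h, ‖a x‖ₑ) := by
        rw [← mul_assoc, ENNReal.mul_inv_cancel h0 h1, one_mul]
    _ ≤ _ := mul_le_mul_right
        (average_le_average_rpow volume h0 h1 (measurable_enorm_coeFn a) hq) _
    _ ≤ _ := ha.volume_mul_average_le hq

theorem lintegral_enorm_rpow_le (hh : 0 < h) (hq : 1 < q) (ha : IsAtomOn q s (cube c h) a) :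
    ∫⁻ x, ‖a x‖ₑ ^ q ≤ volume (cube c h) *
      (ENNReal.ofReal (q / (q - 1)) ^ (-(s⁻¹).toReal) / volume (cube c h)) ^ q := by
  have hq0 : 0 < q := by linarith
  have h0 := volume_cube_ne_zero c hh
  have h1 := volume_cube_ne_top c hh
  have h2 := ha.setLIntegral_eq (F := fun x => x ^ q) (ENNReal.zero_rpow_of_pos hq0)
  rw [← h2]
  have h3 : ((volume (cube c h))⁻¹ * ∫⁻ x in cube c h, ‖a x‖ₑ ^ q) ^ (1 / q) ≤
      ENNReal.ofReal (q / (q - 1)) ^ (-(s⁻¹).toReal) / volume (cube c h) := by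
    rw [ENNReal.le_div_iff_mul_le (Or.inl h0) (Or.inl h1), mul_comm]
    exact ha.volume_mul_average_le hq
  rw [one_div, ENNReal.rpow_inv_le_iff hq0] at h3
  calc _ = volume (cube c h) * ((volume (cube c h))⁻¹ * ∫⁻ x in cube c h, ‖a x‖ₑ ^ q) := by
        rw [← mul_assoc, ENNReal.mul_inv_cancel h0 h1, one_mul]
    _ ≤ _ := mul_le_mul_right h3 _

end IsAtomOn

/-! ### The non-tangential maximal function of a single atom. -/

theorem nontangentialMax_le_maximalFunction [Nontrivial (EuclideanSpace ℝ (Fin n))]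
    (hC : 0 ≤ C) (hφ : ∀ w, ‖φ w‖ ≤ C * ((1 + ‖w‖) ^ (n + 1))⁻¹)
    (a : Lp ℂ 1 (volume : Measure (EuclideanSpace ℝ (Fin n)))) (x : EuclideanSpace ℝ (Fin n)) :
    nontangentialMax φ (Lp.toTemperedDistribution a) x ≤ ENNReal.ofReal (C * 2 ^ (n + 1)) *
      (2 * volume (Metric.ball (0 : EuclideanSpace ℝ (Fin n)) 1)) *
        maximalFunction volume (fun x => ‖a x‖ₑ) x :=
  (coneSup_mono (enorm_apply_dilateReflect_le hC hφ a) x).trans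
    (coneSup_lintegral_le_maximalFunction (measurable_enorm_coeFn a) x)

theorem measurable_nontangentialMax (u : 𝓢'(EuclideanSpace ℝ (Fin n), ℂ)) :
    Measurable (nontangentialMax φ u) :=
  measurable_coneSup fun t ht y => ‖u (dilateReflect φ t ht y)‖ₑ

theorem exists_lintegral_nontangentialMax_le [Nontrivial (EuclideanSpace ℝ (Fin n))]
    (φ : 𝓢(EuclideanSpace ℝ (Fin n), ℂ)) : ∃ K : ℝ≥0, ∀ {q : ℝ} {s : ℝ≥0∞}
    {c : EuclideanSpace ℝ (Fin n)} {h : ℝ}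
    {a : Lp ℂ 1 (volume : Measure (EuclideanSpace ℝ (Fin n)))}, 0 < h → 1 < q →
    IsAtomOn q s (cube c h) a →
    ∫⁻ x, nontangentialMax φ (Lp.toTemperedDistribution a) x ≤
      K * (ENNReal.ofReal (q / (q - 1)) * ENNReal.ofReal (q / (q - 1)) ^ (-(s⁻¹).toReal)) := by
  obtain ⟨C, hC, hφ⟩ := exists_schwartz_decay φ (n + 1)
  have hn : 1 ≤ n := by
    have := Module.finrank_pos (R := ℝ) (M := EuclideanSpace ℝ (Fin n))
    rwa [finrank_euclideanSpace_fin] at this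
  set ω := volume (Metric.ball (0 : EuclideanSpace ℝ (Fin n)) 1) with hω
  have hωt : ω ≠ ∞ := measure_ball_lt_top.ne
  set K₁ : ℝ≥0∞ := ENNReal.ofReal (C * 2 ^ (n + 1)) * (2 * ω)
  set K₂ : ℝ≥0∞ := ENNReal.ofReal (C * 8 ^ (n + 1)) * (2 * ω)
  set K₃ : ℝ≥0∞ := ENNReal.ofReal ((2 * √n) ^ n) + 5 ^ n
  have hK : K₁ * K₃ + K₂ ≠ ∞ := by
    refine ENNReal.add_ne_top.2 ⟨ENNReal.mul_ne_top ?_ ?_, ?_⟩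
    · exact ENNReal.mul_ne_top ENNReal.ofReal_ne_top (ENNReal.mul_ne_top (by simp) hωt)
    · exact ENNReal.add_ne_top.2 ⟨ENNReal.ofReal_ne_top, by simp⟩
    · exact ENNReal.mul_ne_top ENNReal.ofReal_ne_top (ENNReal.mul_ne_top (by simp) hωt)
  refine ⟨(K₁ * K₃ + K₂).toNNReal, ?_⟩
  intro q s c h a hh hq ha
  rw [ENNReal.coe_toNNReal hK]
  have hq1 : 0 < q - 1 := by linarith
  have hp1 : 1 ≤ q / (q - 1) := by rw [le_div_iff₀ hq1]; linarith
  have hp : 0 < q / (q - 1) := zero_lt_one.trans_le hp1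
  set p := q / (q - 1) with hpdef
  set w := ENNReal.ofReal p ^ (-(s⁻¹).toReal) with hw
  have hweq : w = ENNReal.ofReal (p ^ (-(s⁻¹).toReal)) := ENNReal.ofReal_rpow_of_pos hp
  have hw0 : w ≠ 0 := by
    rw [hweq]; exact (ENNReal.ofReal_pos.2 (Real.rpow_pos_of_pos hp _)).ne'
  have hwt : w ≠ ∞ := by rw [hweq]; exact ENNReal.ofReal_ne_top
  set V := volume (cube c h) with hV
  have h0 : V ≠ 0 := volume_cube_ne_zero c hh
  have h1 : V ≠ ∞ := volume_cube_ne_top c hh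
  -- Only the part of the integral near the cube above height `w / V` costs a factor `p`; the other
  -- contributions are of order `w` and are absorbed since `p ≥ 1`.
  have hwpw : w ≤ ENNReal.ofReal p * w :=
    le_mul_of_one_le_left' (by simpa using ENNReal.ofReal_le_ofReal hp1)
  set R := √n * h with hR
  have hR0 : 0 < R := by positivity
  have hL1 : ∫⁻ x, ‖a x‖ₑ ≤ w := ha.lintegral_enorm_le hh hq
  -- The splitting height is `w / V`, the size condition's bound for the `L^q` average of the atom
  -- over its cube.
  have hb : 0 < (w / V).toReal :=
    ENNReal.toReal_pos (ENNReal.div_ne_zero.2 ⟨hw0, h1⟩) (ENNReal.div_ne_top hwt h0)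
  have hbe : ENNReal.ofReal (w / V).toReal = w / V :=
    ENNReal.ofReal_toReal (ENNReal.div_ne_top hwt h0)
  have hnear : ∫⁻ x in Metric.closedBall c (2 * R),
      nontangentialMax φ (Lp.toTemperedDistribution a) x ≤ K₁ * K₃ * (ENNReal.ofReal p * w) := by
    have h2 := setLIntegral_maximalFunction_le volume (measurable_enorm_coeFn a) hq hb
      (V := V) (by rw [hbe]; exact ha.lintegral_enorm_rpow_le hh hq) (Metric.closedBall c (2 * R))
    rw [hbe, finrank_euclideanSpace_fin, ENNReal.mul_div_cancel h0 h1] at h2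
    have h3 : w / V * volume (Metric.closedBall c (2 * R)) ≤
        ENNReal.ofReal ((2 * √n) ^ n) * (ENNReal.ofReal p * w) := by
      calc _ ≤ w / V * (ENNReal.ofReal ((2 * √n) ^ n) * V) := by
            gcongr
            rw [hR, ← mul_assoc]
            exact volume_closedBall_le_volume_cube c hh (by positivity)
        _ = ENNReal.ofReal ((2 * √n) ^ n) * (w / V * V) := by ring
        _ = ENNReal.ofReal ((2 * √n) ^ n) * w := by rw [ENNReal.div_mul_cancel h0 h1]
        _ ≤ _ := by gcongr
    have h4 : 5 ^ n * w * ENNReal.ofReal (q - 1)⁻¹ ≤ 5 ^ n * (ENNReal.ofReal p * w) := by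
      rw [mul_assoc, mul_comm w]
      gcongr
      rw [hpdef, div_eq_mul_inv]
      exact le_mul_of_one_le_left (by positivity) hq.le
    calc _ ≤ ∫⁻ x in Metric.closedBall c (2 * R),
          K₁ * maximalFunction volume (fun x => ‖a x‖ₑ) x :=
          lintegral_mono fun x => nontangentialMax_le_maximalFunction hC (fun w => (hφ w).1) a x
      _ = K₁ * ∫⁻ x in Metric.closedBall c (2 * R),
          maximalFunction volume (fun x => ‖a x‖ₑ) x :=
          lintegral_const_mul _ (measurable_coneSup _)
      _ ≤ K₁ * (ENNReal.ofReal ((2 * √n) ^ n) * (ENNReal.ofReal p * w) +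
            5 ^ n * (ENNReal.ofReal p * w)) := by
          gcongr
          exact h2.trans (add_le_add h3 h4)
      _ = _ := by ring
  have hsupp : ∀ᵐ z, z ∉ Metric.closedBall c R → a z = 0 := by
    filter_upwards [ha.support] with z hz hzc
    exact hz fun h' => hzc (cube_subset_closedBall c hh.le h')
  have hint : ∫ z, a z = 0 := by
    rw [← ha.integral_eq_zero, setIntegral_eq_integral_of_ae_compl_eq_zero ha.support]
  have hfar : ∫⁻ x in (Metric.closedBall c (2 * R))ᶜ,
      nontangentialMax φ (Lp.toTemperedDistribution a) x ≤ K₂ * (ENNReal.ofReal p * w) := by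
    calc _ ≤ ∫⁻ x in (Metric.closedBall c (2 * R))ᶜ, ENNReal.ofReal (C * 8 ^ (n + 1)) * w *
          (ENNReal.ofReal (R ^ Module.finrank ℝ (EuclideanSpace ℝ (Fin n)))⁻¹ *
            dyadicKernel (R⁻¹ • (c - x))) := by
          refine setLIntegral_mono' Metric.isClosed_closedBall.measurableSet.compl fun x hx => ?_
          rw [mem_compl_iff, Metric.mem_closedBall, not_le] at hx
          refine coneSup_le (H := fun t ht y =>
            ‖Lp.toTemperedDistribution a (dilateReflect φ t ht y)‖ₑ) fun t ht y hxy => ?_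
          refine (enorm_apply_dilateReflect_le_of_far hC (fun w => (hφ w).2) hR0 hsupp hint hx.le
            ht hxy).trans ?_
          gcongr
      _ ≤ ∫⁻ x, ENNReal.ofReal (C * 8 ^ (n + 1)) * w *
          (ENNReal.ofReal (R ^ Module.finrank ℝ (EuclideanSpace ℝ (Fin n)))⁻¹ *
            dyadicKernel (R⁻¹ • (c - x))) := setLIntegral_le_lintegral _ _
      _ = ENNReal.ofReal (C * 8 ^ (n + 1)) * w *
          ∫⁻ x, (ENNReal.ofReal (R ^ Module.finrank ℝ (EuclideanSpace ℝ (Fin n)))⁻¹ *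
            dyadicKernel (R⁻¹ • (c - x))) :=
          lintegral_const_mul' _ _ (ENNReal.mul_ne_top ENNReal.ofReal_ne_top hwt)
      _ ≤ ENNReal.ofReal (C * 8 ^ (n + 1)) * w * (2 * ω) := by
          gcongr
          exact lintegral_dyadicKernel_le_const volume c hR0
      _ = K₂ * w := by ring
      _ ≤ _ := by gcongr
  rw [← lintegral_add_compl _ (Metric.isClosed_closedBall (x := c) (ε := 2 * R)).measurableSet,
    add_mul]
  exact add_le_add hnear hfar

/-- Here `2 ^ k ≤ p < 2 ^ (k + 1)`, so `k` replaces `q` as the only parameter and `K` is independent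
of `s`. -/
theorem exists_atom_bounds [Nontrivial (EuclideanSpace ℝ (Fin n))]
    (φ : 𝓢(EuclideanSpace ℝ (Fin n), ℂ)) : ∃ K : ℝ≥0, ∀ (s : ℝ≥0∞), ∀ a ∈ atoms n s,
    ∃ k : ℕ, ∫⁻ x, ‖a x‖ₑ ≤ (2 ^ k) ^ (-(s⁻¹).toReal) ∧
      ∫⁻ x, nontangentialMax φ (Lp.toTemperedDistribution a) x ≤
        K * (2 ^ k * (2 ^ k) ^ (-(s⁻¹).toReal)) := by
  obtain ⟨K, hK⟩ := exists_lintegral_nontangentialMax_le φ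
  refine ⟨K * 2, fun s a ha => ?_⟩
  obtain ⟨q, hq, _, c, h, hh, ha⟩ := ha
  have hp1 : 1 ≤ q / (q - 1) := by rw [le_div_iff₀ (by linarith)]; linarith
  obtain ⟨k, hk1, hk2⟩ := exists_nat_pow_near hp1 one_lt_two
  have e : ∀ m : ℕ, ENNReal.ofReal (2 ^ m) = 2 ^ m := fun m => by
    rw [ENNReal.ofReal_pow zero_le_two]; simp
  have h1 : ENNReal.ofReal (q / (q - 1)) ^ (-(s⁻¹).toReal) ≤ (2 ^ k) ^ (-(s⁻¹).toReal) := by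
    rw [ENNReal.rpow_neg, ENNReal.rpow_neg, ← e k]
    gcongr
  have h2 : ENNReal.ofReal (q / (q - 1)) ≤ 2 * 2 ^ k := by
    rw [mul_comm, ← pow_succ, ← e]
    exact ENNReal.ofReal_le_ofReal hk2.le
  refine ⟨k, (ha.lintegral_enorm_le hh hq).trans h1, (hK hh hq ha).trans ?_⟩
  calc _ ≤ (K : ℝ≥0∞) * (2 * 2 ^ k * (2 ^ k) ^ (-(s⁻¹).toReal)) := by gcongr
    _ = _ := by push_cast; ring

end Atoms

/-! ### The embedding -/

section Embedding

theorem tsum_group (κ : ℕ → ℕ) (x : ℕ → ℝ≥0∞) :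
    ∑' k, ∑' j, (if κ j = k then x j else 0) = ∑' j, x j := by
  rw [ENNReal.tsum_comm]
  exact tsum_congr fun j => by
    simp_rw [eq_comm (a := κ j)]
    exact tsum_ite_eq (κ j) fun _ => x j

/-- Bernoulli's inequality gives `2 ^ (-δ) ≤ 1 - δ / 2`, so the geometric series is at most `2 / δ`.
This is the source of the factor `1 / (1/s - 1/r)`. -/
theorem tsum_dyadic_weight_le {δ : ℝ≥0∞} (h1 : δ ≤ 1) :
    ∑' k : ℕ, δ / 2 * (2 ^ k : ℝ≥0∞) ^ (-δ.toReal) ≤ 1 := by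
  have ht : δ ≠ ∞ := (h1.trans_lt ENNReal.one_lt_top).ne
  have hr1 : δ.toReal ≤ 1 := by simpa using ENNReal.toReal_mono ENNReal.one_ne_top h1
  have hk : ∀ k : ℕ, (2 ^ k : ℝ≥0∞) ^ (-δ.toReal) = ((2 : ℝ≥0∞) ^ (-δ.toReal)) ^ k := fun k => by
    rw [← ENNReal.rpow_natCast, ← ENNReal.rpow_natCast, ← ENNReal.rpow_mul, ← ENNReal.rpow_mul,
      mul_comm]
  have h2 : (2 : ℝ≥0∞) ^ (-δ.toReal) = ENNReal.ofReal (2 ^ (-δ.toReal)) := by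
    rw [← ENNReal.ofReal_rpow_of_pos two_pos]; simp
  have h3 : (2 : ℝ) ^ (-δ.toReal) ≤ 1 - δ.toReal / 2 := by
    have := rpow_one_add_le_one_add_mul_self (s := -(1 / 2)) (by norm_num) ENNReal.toReal_nonneg hr1
    rw [Real.rpow_neg zero_le_two, ← Real.inv_rpow zero_le_two]
    calc (2⁻¹ : ℝ) ^ δ.toReal = (1 + -(1 / 2)) ^ δ.toReal := by norm_num
      _ ≤ _ := this
      _ = _ := by ring
  have h4 : δ / 2 = ENNReal.ofReal (δ.toReal / 2) := by
    rw [ENNReal.ofReal_div_of_pos two_pos, ENNReal.ofReal_toReal ht]; simp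
  simp_rw [hk]
  rw [ENNReal.tsum_mul_left, ENNReal.tsum_geometric, ← div_eq_mul_inv]
  refine ENNReal.div_le_of_le_mul ?_
  rw [one_mul, h2, h4, ← ENNReal.ofReal_one, ← ENNReal.ofReal_sub _ (by positivity)]
  exact ENNReal.ofReal_le_ofReal (by linarith)

variable {n : ℕ}

theorem enorm_toTemperedDistribution_apply_le {𝒜 : Set (Lp ℂ 1
    (volume : Measure (EuclideanSpace ℝ (Fin n))))} {f} {lam : ℕ → ℂ} {a}
    (hf : IsAtomicDecomposition 𝒜 f lam a) (ψ : 𝓢(EuclideanSpace ℝ (Fin n), ℂ)) :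
    ‖Lp.toTemperedDistribution f ψ‖ₑ ≤
      ∑' j, ‖lam j‖ₑ * ‖Lp.toTemperedDistribution (a j) ψ‖ₑ := by
  have hsum : HasSum (fun j => lam j • Lp.toTemperedDistribution (a j) ψ)
      (Lp.toTemperedDistribution f ψ) := by
    have h := hf.2.2.mapL ((PointwiseConvergenceCLM.evalCLM (RingHom.id ℂ) ℂ ψ).comp
      (Lp.toTemperedDistributionCLM ℂ volume 1))
    simp only [map_smul] at h
    exact h
  rw [← hsum.tsum_eq]
  refine enorm_tsum_le_tsum_enorm.trans ?_
  simp only [enorm_smul]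
  exact le_rfl

theorem exists_hardyLorentzNorm_le [Nontrivial (EuclideanSpace ℝ (Fin n))]
    (φ : 𝓢(EuclideanSpace ℝ (Fin n), ℂ)) : ∃ K : ℝ≥0, ∀ s r : ℝ≥0∞, 1 < s → s < r →
    ∀ f lam a, IsAtomicDecomposition (atoms n s) f lam a →
    hardyLorentzNorm φ r (Lp.toTemperedDistribution f) ≤
      K / (s⁻¹ - r⁻¹) * ∑' j, ‖lam j‖ₑ := by
  obtain ⟨C, hC, hφ⟩ := exists_schwartz_decay φ (n + 1)
  obtain ⟨K, hK⟩ := exists_atom_bounds φ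
  -- The `+ 1` only ensures `K₁ ≠ 0`, so that levels can be divided by it.
  set K₁ : ℝ≥0∞ := ENNReal.ofReal (C * 2 ^ (n + 1)) *
    (2 * volume (Metric.ball (0 : EuclideanSpace ℝ (Fin n)) 1)) + 1 with hK₁
  have hK₁t : K₁ ≠ ∞ := ENNReal.add_ne_top.2 ⟨ENNReal.mul_ne_top ENNReal.ofReal_ne_top
    (ENNReal.mul_ne_top (by simp) measure_ball_lt_top.ne), by simp⟩
  have hK₁0 : K₁ ≠ 0 := by simp [hK₁]
  set K₂ : ℝ≥0∞ := K₁ * 5 ^ n + K with hK₂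
  have hK₂t : K₂ ≠ ∞ := ENNReal.add_ne_top.2 ⟨ENNReal.mul_ne_top hK₁t (by simp), by simp⟩
  refine ⟨(2 * K₂).toNNReal, fun s r hs hsr f lam a hf => ?_⟩
  rw [ENNReal.coe_toNNReal (ENNReal.mul_ne_top (by simp) hK₂t)]
  choose κ hκ1 hκ2 using fun j => hK s (a j) (hf.1 j)
  set σ := (s⁻¹).toReal with hσ
  set ρ := (r⁻¹).toReal with hρ
  set δ := s⁻¹ - r⁻¹ with hδ
  have hs1 : s⁻¹ ≤ 1 := ENNReal.inv_le_one.2 hs.le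
  have hδ1 : δ ≤ 1 := tsub_le_self.trans hs1
  have hδ0 : δ ≠ 0 := (tsub_pos_of_lt (ENNReal.inv_lt_inv.2 hsr)).ne'
  have hδt : δ ≠ ∞ := (hδ1.trans_lt ENNReal.one_lt_top).ne
  have hδr : δ.toReal = σ - ρ := ENNReal.toReal_sub_of_le (ENNReal.inv_le_inv.2 hsr.le)
    (hs1.trans_lt ENNReal.one_lt_top).ne
  let Λ : ℕ → ℝ≥0∞ := fun k => ∑' j, if κ j = k then ‖lam j‖ₑ else 0
  let F : ℕ → EuclideanSpace ℝ (Fin n) → ℝ≥0∞ := fun k x =>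
    ∑' j, (if κ j = k then ‖lam j‖ₑ else 0) * ‖a j x‖ₑ
  -- The supremum is taken after summing over the group: `G k` is then dominated by the maximal
  -- function of the single function `F k`, which avoids adding weak `L¹` bounds atom by atom.
  let G : ℕ → EuclideanSpace ℝ (Fin n) → ℝ≥0∞ := fun k => coneSup fun t ht y =>
    ∑' j, (if κ j = k then ‖lam j‖ₑ else 0) *
      ‖Lp.toTemperedDistribution (a j) (dilateReflect φ t ht y)‖ₑ
  have hFmeas : ∀ k, Measurable (F k) := fun k =>
    Measurable.tsum fun j => (measurable_enorm_coeFn (a j)).const_mul _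
  have hFint : ∀ k, ∫⁻ x, F k x ≤ (2 ^ k) ^ (-σ) * Λ k := by
    intro k
    rw [lintegral_tsum fun j => ((measurable_enorm_coeFn (a j)).const_mul _).aemeasurable,
      ← ENNReal.tsum_mul_left]
    refine ENNReal.tsum_le_tsum fun j => ?_
    rw [lintegral_const_mul _ (measurable_enorm_coeFn (a j)), mul_comm]
    split_ifs with h
    · rw [← h]
      gcongr
      exact hκ1 j
    · simp
  have hdom : ∀ x, nontangentialMax φ (Lp.toTemperedDistribution f) x ≤ ∑' k, G k x := by
    intro x
    refine coneSup_le (H := fun t ht y =>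
      ‖Lp.toTemperedDistribution f (dilateReflect φ t ht y)‖ₑ) fun t ht y hxy => ?_
    refine (enorm_toTemperedDistribution_apply_le hf _).trans ?_
    rw [← tsum_group κ]
    refine ENNReal.tsum_le_tsum fun k => ?_
    simp only [← ite_zero_mul]
    exact le_coneSup (H := fun t ht y => ∑' j, (if κ j = k then ‖lam j‖ₑ else 0) *
      ‖Lp.toTemperedDistribution (a j) (dilateReflect φ t ht y)‖ₑ) ht hxy
  have hGF : ∀ k x, G k x ≤ K₁ * maximalFunction volume (F k) x := by
    intro k x
    refine (coneSup_mono (fun t ht y => ?_) x).trans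
      ((coneSup_lintegral_le_maximalFunction (C := ENNReal.ofReal (C * 2 ^ (n + 1)))
        (hFmeas k) x).trans (mul_le_mul_left le_self_add _))
    have hker : ∀ j, AEMeasurable (fun z => (if κ j = k then ‖lam j‖ₑ else 0) * (‖a j z‖ₑ *
        (ENNReal.ofReal (t ^ Module.finrank ℝ (EuclideanSpace ℝ (Fin n)))⁻¹ *
          dyadicKernel (t⁻¹ • (y - z))))) := by
      intro j
      refine (((measurable_enorm_coeFn (a j)).mul
        (Measurable.const_mul ?_ _)).const_mul _).aemeasurable
      exact measurable_dyadicKernel.comp (by fun_prop)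
    calc _ ≤ ∑' j, (if κ j = k then ‖lam j‖ₑ else 0) * (ENNReal.ofReal (C * 2 ^ (n + 1)) *
          ∫⁻ z, ‖a j z‖ₑ *
          (ENNReal.ofReal (t ^ Module.finrank ℝ (EuclideanSpace ℝ (Fin n)))⁻¹ *
            dyadicKernel (t⁻¹ • (y - z)))) := by
          refine ENNReal.tsum_le_tsum fun j => mul_le_mul_right ?_ _
          exact enorm_apply_dilateReflect_le hC (fun w => (hφ w).1) (a j) t ht y
      _ = ENNReal.ofReal (C * 2 ^ (n + 1)) * ∑' j, ∫⁻ z, (if κ j = k then ‖lam j‖ₑ else 0) *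
          (‖a j z‖ₑ * (ENNReal.ofReal (t ^ Module.finrank ℝ (EuclideanSpace ℝ (Fin n)))⁻¹ *
            dyadicKernel (t⁻¹ • (y - z)))) := by
          rw [← ENNReal.tsum_mul_left]
          refine tsum_congr fun j => ?_
          rw [lintegral_const_mul' _ _ (by split_ifs <;> simp)]
          ring
      _ = _ := by
          rw [← lintegral_tsum hker]
          congr 1
          refine lintegral_congr fun z => ?_
          simp only [F, ← mul_assoc, ENNReal.tsum_mul_right]
  have hweak : ∀ k y, y * volume {x | y < G k x} ≤ K₂ * ((2 ^ k) ^ (-σ) * Λ k) := by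
    intro k y
    calc y * volume {x | y < G k x}
        ≤ y * volume {x | y / K₁ < maximalFunction volume (F k) x} := by
          refine mul_le_mul_right (measure_mono fun x hx => ?_) _
          refine ENNReal.div_lt_of_lt_mul ?_
          rw [mul_comm]
          exact lt_of_lt_of_le hx (hGF k x)
      _ = K₁ * (y / K₁ * volume {x | y / K₁ < maximalFunction volume (F k) x}) := by
          rw [← mul_assoc, ENNReal.mul_div_cancel hK₁0 hK₁t]
      _ ≤ K₁ * (5 ^ n * ∫⁻ x, F k x) := by
          have := mul_measure_lt_maximalFunction_le volume (G := F k) (y / K₁)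
          rw [finrank_euclideanSpace_fin] at this
          exact mul_le_mul_right this _
      _ ≤ K₁ * (5 ^ n * ((2 ^ k) ^ (-σ) * Λ k)) := by
          gcongr
          exact hFint k
      _ ≤ _ := by
          rw [← mul_assoc]
          exact mul_le_mul_left le_self_add _
  have hstrong : ∀ k, ∫⁻ x, G k x ≤ 2 ^ k * (K₂ * ((2 ^ k) ^ (-σ) * Λ k)) := by
    intro k
    have hle : ∀ x, G k x ≤ ∑' j, (if κ j = k then ‖lam j‖ₑ else 0) *
        nontangentialMax φ (Lp.toTemperedDistribution (a j)) x := fun x =>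
      coneSup_le fun t ht y hxy => ENNReal.tsum_le_tsum fun j => mul_le_mul_right
        (le_coneSup (H := fun t ht y =>
          ‖Lp.toTemperedDistribution (a j) (dilateReflect φ t ht y)‖ₑ) ht hxy) _
    refine (lintegral_mono hle).trans ?_
    rw [lintegral_tsum fun j => ((measurable_nontangentialMax _).const_mul _).aemeasurable]
    calc _ ≤ ∑' j, (if κ j = k then ‖lam j‖ₑ else 0) * (K * (2 ^ k * (2 ^ k) ^ (-σ))) := by
          refine ENNReal.tsum_le_tsum fun j => ?_
          rw [lintegral_const_mul _ (measurable_nontangentialMax _)]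
          split_ifs with h
          · rw [← h]
            exact mul_le_mul_right (hκ2 j) _
          · simp
      _ = 2 ^ k * (K * ((2 ^ k) ^ (-σ) * Λ k)) := by
          rw [ENNReal.tsum_mul_right]; ring
      _ ≤ _ := by
          gcongr
          exact le_add_self
  have h2k0 : ∀ k : ℕ, (2 ^ k : ℝ≥0∞) ≠ 0 := fun k => by positivity
  have h2kt : ∀ k : ℕ, (2 ^ k : ℝ≥0∞) ≠ ∞ := fun k => by simp
  have hmain := lorentzNorm_le_tsum (hs.le.trans hsr.le) hdom (fun k => measurable_coneSup _)
    (c := fun k => δ / 2 * (2 ^ k : ℝ≥0∞) ^ (-δ.toReal))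
    (fun k => mul_ne_zero (ENNReal.div_ne_zero.2 ⟨hδ0, by simp⟩)
      (ENNReal.rpow_pos (pos_iff_ne_zero.2 (h2k0 k)) (h2kt k)).ne')
    (tsum_dyadic_weight_le hδ1) hweak hstrong
  refine hmain.trans (le_of_eq ?_)
  rw [← tsum_group κ fun j => ‖lam j‖ₑ, ← ENNReal.tsum_mul_left]
  refine tsum_congr fun k => ?_
  -- The decay of the atoms, the cost of the weight and the interpolation loss cancel exactly.
  have hx : ((2 ^ k : ℝ≥0∞)) ^ (-σ) * (2 ^ k) ^ δ.toReal * (2 ^ k) ^ ρ = 1 := by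
    rw [← ENNReal.rpow_add _ _ (h2k0 k) (h2kt k), ← ENNReal.rpow_add _ _ (h2k0 k) (h2kt k), hδr,
      show -σ + (σ - ρ) + ρ = 0 by ring, ENNReal.rpow_zero]
  have hinv : (δ / 2 * (2 ^ k : ℝ≥0∞) ^ (-δ.toReal))⁻¹ = 2 / δ * (2 ^ k) ^ δ.toReal := by
    rw [ENNReal.mul_inv (Or.inl (ENNReal.div_ne_zero.2 ⟨hδ0, by simp⟩))
      (Or.inl (ENNReal.div_ne_top hδt (by simp))), ENNReal.rpow_neg, inv_inv,
      ENNReal.inv_div (by simp) (by simp)]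
  calc K₂ * ((2 ^ k) ^ (-σ) * Λ k) / (δ / 2 * (2 ^ k : ℝ≥0∞) ^ (-δ.toReal)) * (2 ^ k) ^ ρ
      = K₂ * (2 / δ) * Λ k * ((2 ^ k : ℝ≥0∞) ^ (-σ) * (2 ^ k) ^ δ.toReal * (2 ^ k) ^ ρ) := by
        rw [div_eq_mul_inv, hinv]; ring
    _ = _ := by
        rw [hx, mul_one, div_eq_mul_inv, div_eq_mul_inv]; ring

end Embedding

end HardyLorentz

end

theorem proposition2p2 (n : ℕ) (hn : 1 ≤ n) (φ : 𝓢(EuclideanSpace ℝ (Fin n), ℂ))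
    (hφ : ∫ x, φ x ≠ 0) :
    ∃ C : ℝ≥0, ∀ s r : ℝ≥0∞, 1 < s → s < r → ∀ f ∈ HardyLorentz.X n s,
      MeasureTheory.Lp.toTemperedDistribution f ∈ HardyLorentz.H1 φ r ∧
      HardyLorentz.hardyLorentzNorm φ r (MeasureTheory.Lp.toTemperedDistribution f) ≤
        C / (s⁻¹ - r⁻¹) * HardyLorentz.XNorm s f := by
  have : Nontrivial (EuclideanSpace ℝ (Fin n)) :=
    Module.nontrivial_of_finrank_pos (R := ℝ) (by rw [finrank_euclideanSpace_fin]; exact hn)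
  obtain ⟨K, hK⟩ := HardyLorentz.exists_hardyLorentzNorm_le φ
  refine ⟨K, fun s r hs hsr f hf => ?_⟩
  have hδ0 : s⁻¹ - r⁻¹ ≠ 0 := (tsub_pos_of_lt (ENNReal.inv_lt_inv.2 hsr)).ne'
  have hKt : (K : ℝ≥0∞) / (s⁻¹ - r⁻¹) ≠ ∞ := ENNReal.div_ne_top ENNReal.coe_ne_top hδ0
  have hfin : HardyLorentz.XNorm s f ≠ ∞ := by
    obtain ⟨lam, a, h⟩ := hf
    refine ne_top_of_le_ne_top (tsum_enorm_ne_top_iff_summable_norm.2 h.2.1) ?_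
    exact iInf_le_of_le lam <| iInf_le_of_le a <| iInf_le_of_le h le_rfl
  have hle : HardyLorentz.hardyLorentzNorm φ r (MeasureTheory.Lp.toTemperedDistribution f) ≤
      K / (s⁻¹ - r⁻¹) * HardyLorentz.XNorm s f := by
    -- Dividing by the constant allows passage to the infimum over decompositions; finiteness of the
    -- norm covers a zero constant.
    rw [mul_comm, ← ENNReal.div_le_iff_le_mul (Or.inr hfin) (Or.inl hKt)]
    refine le_iInf fun lam => le_iInf fun a => le_iInf fun h => ENNReal.div_le_of_le_mul ?_
    rw [mul_comm]
    exact hK s r hs hsr f lam a h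
  exact ⟨⟨(HardyLorentz.measurable_nontangentialMax _).aemeasurable,
    hle.trans_lt (ENNReal.mul_lt_top hKt.lt_top hfin.lt_top)⟩, hle⟩
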